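/- **Setting.** There are $K\ge 1$ source-destination pairs and a reconfigurable intelligent surface (RIS) with $M$ elements. Contention $n=1,2,\dots$ consists of slots; in each slot source $k$ sends an RTS independently with probability $p_k\in[0,1]$. An idle slot lasts $\delta$, a slot with a collision lasts $\tau_R$, and the first slot with exactly one sender ends the contention: that sender is the winner $w(n)$, and this slot lasts $\tau_{M,1}=\tau_R+\tau_C$. Let $t(n)$ be the duration of contention $n$. Put $p_s=\sum_k p_k\prod_{i\ne k}(1-p_i)$, assumed positive, $\pi_k=p_k\prod_{i\neq k}(1-p_i)/p_s$, and $\tau_{M,2}=\tau_{M,1}+\tau_p+\tau_C$, with $\delta,\tau_R,\tau_C,\tau_p>0$ and $\tau_d\ge\tau_{M,2}$. At contention $n$ the channel coefficients are $h_k(n)\sim\mathcal{CN}(0,d_k^{-\alpha_1})$, $f_{k,m}(n)\sim\mathcal{CN}(0,d_{k,1}^{-\alpha_2})$, $g_{k,m}(n)\sim\mathcal{CN}(0,d_{k,2}^{-\alpha_2})$, with $d_k,d_{k,1},d_{k,2}>0$; all of them, over all $n,k,m$, and all RTS decisions are mutually independent. With $\bar\rho=P_tG_tG_r\beta_0/N_0$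 (all factors positive) let $$R_{k,d}=\log_2(1+\bar\rho|h_k|^2),\qquad R_{k,r}=\log_2\Big(1+\bar\rho\big(|h_k|+\textstyle\sum_m|f_{k,m}||g_{k,m}|\big)^2\Big).$$ **Strategies.** After contention $n$ the destination of the winner observes $w(n),t(n),h_{w(n)}(n)$ and decides to *stop* (transmit over the direct link, $Y=(\tau_d-\tau_{M,1})R_{w(n),d}$), to *continue* (start contention $n+1$), or to *assist*, i.e. to probe the RIS. Probing takes the time $\tau_p+\tau_C$ and reveals $(f_{w(n),m}(n)g_{w(n),m}(n))_m$; then the destination decides to *stop* (transmit with the help of the RIS, $Y=(\tau_d-\tau_{M,2})R_{w(n),r}$) or to *continue*. Every decision is a measurable function of what has been observed so far. If the strategy stops at contention $n$ and $a_l=1$ or $0$ according to whether the RIS was probed at contention $l$, the time cost is $$T=\sum_{l=1}^n t(l)+\sum_{l=1}^{n-1}a_l(\tau_p+\tau_C)+\tau_d-\tau_{M,1}.$$ A strategy is feasible if it stops almost surely and $\mathbb E[T]<\infty$; its throughput is $\mathbb E[Y]/\mathbb E[T]$. Let $$\Lambda_k(\lambda,x)=\mathbb E\Big[\max\Big\{(\tau_d-\tau_{M,2})\log_2\Big(1+\bar\rho\big(x+\textstyle\sum_m|f_{k,m}||g_{k,m}|\big)^2\Big)-\lambda(\tau_d-\tau_{M,1}),\,-\lambda(\tau_p+\tau_C)\Big\}\Big].$$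 **Theorem.** (a) For all $n$ and $k$, $\mathbb P(w(n)=k)=\pi_k$, and $$\mathbb E[t(n)]=\tau_o:=\tau_{M,1}+\prod_k(1-p_k)\frac{\delta}{p_s}+\Big(1-\prod_k(1-p_k)-p_s\Big)\frac{\tau_R}{p_s}.$$ The amplitude $|h_k|$ is Rayleigh distributed, with c.d.f. $F_{|h_k|}(x)=1-\exp(-x^2/d_k^{-\alpha_1})$ for $x\ge0$. The rate $R_{k,r}$ is the largest value of $\log_2(1+\bar\rho|h_k+\sum_m f_{k,m}e^{j\phi_m}g_{k,m}|^2)$ over all phases $\phi$, attained at $\phi_m=\arg h_k-\arg(f_{k,m}g_{k,m})$ modulo $2\pi$. (b) The expectation defining $\Lambda_k(\lambda,x)$ exists for every real $\lambda$ and $x\ge0$, the integrals in the equation $$\sum_{k=1}^K\pi_k\int_0^\infty\max\big\{(\log_2(1+\bar\rho x^2)-\lambda)(\tau_d-\tau_{M,1}),\,\Lambda_k(\lambda,x),\,0\big\}\,dF_{|h_k|}(x)=\lambda\tau_o$$ exist, and the equation has exactly one real root $\lambda^*$; moreover $\lambda^*>0$. If all $p_k$ are equal, $\lambda^*$ is also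 the unique root of the same equation with every weight $\pi_k$ replaced by $1/K$. (c) Every feasible strategy has $\mathbb E[Y]<\infty$ and throughput at most $\lambda^*$. The following rule defines a feasible strategy with throughput exactly $\lambda^*$. After contention $n$, with $D=(\tau_d-\tau_{M,1})(R_{w(n),d}-\lambda^*)$ and $\Lambda=\Lambda_{w(n)}(\lambda^*,|h_{w(n)}(n)|)$: if $D\ge\max\{\Lambda,0\}$, stop; if $\max\{D,\Lambda\}<0$, continue; otherwise probe the RIS, and then stop if $R_{w(n),r}\ge\lambda^*$ and continue otherwise. -/

import Mathlib

open MeasureTheory ProbabilityTheory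

noncomputable section

namespace RISCSMA

/-- System constants of a network with `K` source-destination pairs and a RIS with `M` elements.
`p k` is the probability that source `k` sends an RTS in a contention slot; `d k`, `d₁ k`, `d₂ k`
are the distances of the direct link and of the two hops through the RIS; `α₁`, `α₂` are the
path-loss exponents; `Pt Gt Gr β₀ N₀` are transmit power, antenna gains, reference path loss and
noise power in linear scale; `τR τC τp τd δ` are the durations of RTS, CTS, pilots, channel
coherence and of an idle contention slot. -/
structure Params (K M : ℕ) where
  p : Fin K → ℝ
  d : Fin K → ℝ
  d₁ : Fin K → ℝ
  d₂ : Fin K → ℝ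
  α₁ : ℝ
  α₂ : ℝ
  Pt : ℝ
  Gt : ℝ
  Gr : ℝ
  β₀ : ℝ
  N₀ : ℝ
  τR : ℝ
  τC : ℝ
  τp : ℝ
  τd : ℝ
  δ : ℝ
  p_nonneg : ∀ k, 0 ≤ p k
  p_le_one : ∀ k, p k ≤ 1
  /-- a contention slot is successful with positive probability -/
  ps_pos : 0 < ∑ k, p k * ∏ i ∈ Finset.univ.erase k, (1 - p i)
  d_pos : ∀ k, 0 < d k
  d₁_pos : ∀ k, 0 < d₁ k
  d₂_pos : ∀ k, 0 < d₂ k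
  Pt_pos : 0 < Pt
  Gt_pos : 0 < Gt
  Gr_pos : 0 < Gr
  β₀_pos : 0 < β₀
  N₀_pos : 0 < N₀
  τR_pos : 0 < τR
  τC_pos : 0 < τC
  τp_pos : 0 < τp
  δ_pos : 0 < δ
  /-- the transmission time that remains after probing the RIS is not negative -/
  probing_le : (τR + τC) + τp + τC ≤ τd

/-- The circularly symmetric complex Gaussian law `CN(0, v)`: real and imaginary part are
independent centred Gaussians of variance `v / 2`. -/
def complexGaussian (v : ℝ) : Measure ℂ :=
  ((gaussianReal 0 (v / 2).toNNReal).prod (gaussianReal 0 (v / 2).toNNReal)).map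
    (fun z : ℝ × ℝ => (⟨z.1, z.2⟩ : ℂ))

namespace Params

variable {K M : ℕ} (c : Params K M)

/-- `τ_{M,1}`. -/
def τM1 : ℝ := c.τR + c.τC

/-- `τ_{M,2}`. -/
def τM2 : ℝ := c.τM1 + c.τp + c.τC

/-- The average SNR factor `ρ̄`. -/
def ρ : ℝ := c.Pt * c.Gt * c.Gr * c.β₀ / c.N₀

/-- Law of the direct-link coefficient `h_k`. -/
def lawH (k : Fin K) : Measure ℂ := complexGaussian (c.d k ^ (-c.α₁))

/-- Law of a first-hop coefficient `f_{k,m}`. -/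
def lawF (k : Fin K) : Measure ℂ := complexGaussian (c.d₁ k ^ (-c.α₂))

/-- Law of a second-hop coefficient `g_{k,m}`. -/
def lawG (k : Fin K) : Measure ℂ := complexGaussian (c.d₂ k ^ (-c.α₂))

/-- Law of the amplitude `|h_k|`. -/
def lawAbsH (k : Fin K) : Measure ℝ := (c.lawH k).map (fun z => ‖z‖)

/-- Probability that a contention slot is successful. -/
def ps : ℝ := ∑ k, c.p k * ∏ i ∈ Finset.univ.erase k, (1 - c.p i)

/-- Probability `π_k` that pair `k` is the winner of a successful contention. -/
def winProb (k : Fin K) : ℝ := (c.p k * ∏ i ∈ Finset.univ.erase k, (1 - c.p i)) / c.ps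

/-- The average duration `τ_o` of a successful contention. -/
def τo : ℝ :=
  c.τM1 + (∏ k, (1 - c.p k)) * (c.δ / c.ps) + (1 - (∏ k, (1 - c.p k)) - c.ps) * (c.τR / c.ps)

/-- Direct-link rate for direct-link amplitude `x`. -/
def rateD (x : ℝ) : ℝ := Real.logb 2 (1 + c.ρ * x ^ 2)

/-- RIS-assisted rate (with optimal phases) for direct-link amplitude `x` and cascaded
coefficients `q m = f m * g m`. -/
def rateR (x : ℝ) (q : Fin M → ℂ) : ℝ := Real.logb 2 (1 + c.ρ * (x + ∑ m, ‖q m‖) ^ 2)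

/-- RIS-assisted rate when the RIS elements apply the phases `φ`. -/
def ratePhase (φ : Fin M → ℝ) (h : ℂ) (f g : Fin M → ℂ) : ℝ :=
  Real.logb 2 (1 + c.ρ *
    ‖h + f ⬝ᵥ Matrix.mulVec (Matrix.diagonal fun m => Complex.exp (φ m * Complex.I)) g‖ ^ 2)

/-- Immediate net reward of transmitting over the direct link at price `lam`. -/
def direct (lam x : ℝ) : ℝ := (c.τd - c.τM1) * (c.rateD x - lam)

/-- Best net reward at price `lam` once the RIS link has been probed. -/
def probed (lam x : ℝ) (q : Fin M → ℂ) : ℝ :=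
  max ((c.τd - c.τM2) * c.rateR x q - lam * (c.τd - c.τM1)) (-lam * (c.τp + c.τC))

/-- Joint law of the two hops of pair `k` through the RIS. -/
def lawFG (k : Fin K) : Measure ((Fin M → ℂ) × (Fin M → ℂ)) :=
  (Measure.pi fun _ : Fin M => c.lawF k).prod (Measure.pi fun _ : Fin M => c.lawG k)

/-- The function `Λ_k(lam, x)`: expected value of probing the RIS link of pair `k`. -/
def Λ (k : Fin K) (lam x : ℝ) : ℝ :=
  ∫ y, c.probed lam x (fun m => y.1 m * y.2 m) ∂(c.lawFG k)

/-- Integrand of the fixed-point equation. -/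
def gain (k : Fin K) (lam x : ℝ) : ℝ := max (max (c.direct lam x) (c.Λ k lam x)) 0

end Params

/-- Optimal phases `arg h - arg (f_m g_m)`, taken in `[0, 2π)`. -/
def optPhase {M : ℕ} (h : ℂ) (f g : Fin M → ℂ) (m : Fin M) : ℝ :=
  toIcoMod Real.two_pi_pos 0 (h.arg - (f m * g m).arg)

/-- The randomness of one round of data transmission on a probability space `(Ω, P)`:
`send n s k` says whether source `k` sends an RTS in slot `s` of the `n`-th contention, and
`h n k`, `f n k m`, `g n k m` are the channel coefficients at the `n`-th contention
(`n = 0, 1, 2, …`). All these variables are mutually independent. -/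
structure Network {K M : ℕ} (c : Params K M) {Ω : Type*} [MeasurableSpace Ω]
    (P : Measure Ω) where
  send : ℕ → ℕ → Fin K → Ω → Bool
  h : ℕ → Fin K → Ω → ℂ
  f : ℕ → Fin K → Fin M → Ω → ℂ
  g : ℕ → Fin K → Fin M → Ω → ℂ
  measurable_send : ∀ n s k, Measurable (send n s k)
  measurable_h : ∀ n k, Measurable (h n k)
  measurable_f : ∀ n k m, Measurable (f n k m)
  measurable_g : ∀ n k m, Measurable (g n k m)
  law_send : ∀ n s k, P {ω | send n s k ω = true} = ENNReal.ofReal (c.p k)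
  law_h : ∀ n k, P.map (h n k) = c.lawH k
  law_f : ∀ n k m, P.map (f n k m) = c.lawF k
  law_g : ∀ n k m, P.map (g n k m) = c.lawG k
  indep : iIndep
    (Sum.elim (fun i : ℕ × ℕ × Fin K => MeasurableSpace.comap (send i.1 i.2.1 i.2.2) inferInstance)
      (Sum.elim (fun i : ℕ × Fin K => MeasurableSpace.comap (h i.1 i.2) inferInstance)
        (Sum.elim
          (fun i : ℕ × Fin K × Fin M =>
            MeasurableSpace.comap (f i.1 i.2.1 i.2.2) inferInstance)
          (fun i : ℕ × Fin K × Fin M =>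
            MeasurableSpace.comap (g i.1 i.2.1 i.2.2) inferInstance)))) P

/-- Decisions of the winning destination after its first observation: stop and use the direct link,
continue with a new contention, or probe the RIS link. -/
inductive Action
  | halt
  | cont
  | assist

instance : MeasurableSpace Action := ⊤

/-- Decisions at every contention: `first n` after the direct link has been observed, and
`second n` (`true` is stop, `false` is continue), which counts only if `first n` is `assist`. -/
structure Strategy (Ω : Type*) where
  first : ℕ → Ω → Action
  second : ℕ → Ω → Bool

namespace Network

variable {K M : ℕ} [NeZero K] {c : Params K M} {Ω : Type*} [MeasurableSpace Ω] {P : Measure Ω}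
variable (N : Network c P)

/-- In slot `s` of contention `n`, source `k` is the only one that sends an RTS. -/
def Sole (n s : ℕ) (k : Fin K) (ω : Ω) : Prop :=
  N.send n s k ω = true ∧ ∀ j, j ≠ k → N.send n s j ω = false

/-- The first successful slot of contention `n` (it exists almost surely). -/
def winSlot (n : ℕ) (ω : Ω) : ℕ := sInf {s | ∃ k, N.Sole n s k ω}

/-- The winner `w(n)`. -/
def w (n : ℕ) (ω : Ω) : Fin K := Classical.epsilon fun k => N.Sole n (N.winSlot n ω) k ω

open Classical in
/-- The duration of contention `n`: an idle slot takes `δ`, a collision takes `τR`, and the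
successful exchange takes `τR + τC`. -/
def t (n : ℕ) (ω : Ω) : ℝ :=
  (∑ s ∈ Finset.range (N.winSlot n ω), if ∀ k, N.send n s k ω = false then c.δ else c.τR) + c.τM1

/-- The direct-link coefficient of the winner. -/
def hw (n : ℕ) (ω : Ω) : ℂ := N.h n (N.w n ω) ω

/-- The cascaded RIS coefficients of the winner. -/
def qw (n : ℕ) (ω : Ω) : Fin M → ℂ := fun m => N.f n (N.w n ω) m ω * N.g n (N.w n ω) m ω

/-- First observation at contention `n`. -/
def obs (n : ℕ) (ω : Ω) : Fin K × ℝ × ℂ := (N.w n ω, N.t n ω, N.hw n ω)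

open Classical in
/-- Second observation at contention `n`: nothing is revealed unless the RIS is probed. -/
def seen (S : Strategy Ω) (n : ℕ) (ω : Ω) : Fin M → ℂ :=
  if S.first n ω = Action.assist then N.qw n ω else 0

/-- Information available for the first decision at contention `n`. -/
@[reducible] def info₁ (S : Strategy Ω) (n : ℕ) : MeasurableSpace Ω :=
  (⨆ l : ℕ, ⨆ _ : l ≤ n, MeasurableSpace.comap (N.obs l) inferInstance) ⊔
    ⨆ l : ℕ, ⨆ _ : l < n, MeasurableSpace.comap (N.seen S l) inferInstance

/-- Information available for the second decision at contention `n`. -/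
@[reducible] def info₂ (S : Strategy Ω) (n : ℕ) : MeasurableSpace Ω :=
  N.info₁ S n ⊔ MeasurableSpace.comap (N.seen S n) inferInstance

/-- Every decision depends only on what has been observed along the observation path. -/
def Admissible (S : Strategy Ω) : Prop :=
  ∀ n, Measurable[N.info₁ S n] (S.first n) ∧ Measurable[N.info₂ S n] (S.second n)

end Network

/-- The strategy stops at contention `n`, if it has not stopped before. -/
def Strategy.StopsAt {Ω : Type*} (S : Strategy Ω) (n : ℕ) (ω : Ω) : Prop :=
  S.first n ω = Action.halt ∨ (S.first n ω = Action.assist ∧ S.second n ω = true)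

/-- Index of the contention at which the strategy stops. -/
def Strategy.stopIdx {Ω : Type*} (S : Strategy Ω) (ω : Ω) : ℕ := sInf {n | S.StopsAt n ω}

namespace Network

variable {K M : ℕ} [NeZero K] {c : Params K M} {Ω : Type*} [MeasurableSpace Ω] {P : Measure Ω}
variable (N : Network c P)

open Classical in
/-- Transmitted data `Y`. -/
def Y (S : Strategy Ω) (ω : Ω) : ℝ :=
  if S.first (S.stopIdx ω) ω = Action.halt then
    (c.τd - c.τM1) * c.rateD ‖N.hw (S.stopIdx ω) ω‖
  else
    (c.τd - c.τM2) * c.rateR ‖N.hw (S.stopIdx ω) ω‖ (N.qw (S.stopIdx ω) ω)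

open Classical in
/-- Time cost `T`, including the data transmission. -/
def T (S : Strategy Ω) (ω : Ω) : ℝ :=
  (∑ l ∈ Finset.range (S.stopIdx ω + 1), N.t l ω) +
    (∑ l ∈ Finset.range (S.stopIdx ω), if S.first l ω = Action.assist then c.τC + c.τp else 0) +
    (c.τd - c.τM1)

/-- Feasible strategies: admissible, almost surely ending with a transmission, and of finite
expected duration. -/
def Feasible (S : Strategy Ω) : Prop :=
  N.Admissible S ∧ (∀ᵐ ω ∂P, ∃ n, S.StopsAt n ω) ∧ Integrable (N.T S) P

/-- Average throughput `E[Y] / E[T]`. -/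
def throughput (S : Strategy Ω) : ℝ := (∫ ω, N.Y S ω ∂P) / (∫ ω, N.T S ω ∂P)

/-- The decision rule with price `lam`. -/
def FollowsRule (lam : ℝ) (S : Strategy Ω) : Prop :=
  ∀ n ω,
    (max (c.Λ (N.w n ω) lam ‖N.hw n ω‖) 0 ≤ c.direct lam ‖N.hw n ω‖ →
      S.first n ω = Action.halt) ∧
    (max (c.direct lam ‖N.hw n ω‖) (c.Λ (N.w n ω) lam ‖N.hw n ω‖) < 0 →
      S.first n ω = Action.cont) ∧
    (¬ max (c.Λ (N.w n ω) lam ‖N.hw n ω‖) 0 ≤ c.direct lam ‖N.hw n ω‖ →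
      ¬ max (c.direct lam ‖N.hw n ω‖) (c.Λ (N.w n ω) lam ‖N.hw n ω‖) < 0 →
      S.first n ω = Action.assist ∧
        (S.second n ω = true ↔ lam ≤ c.rateR ‖N.hw n ω‖ (N.qw n ω)))

end Network

end RISCSMA

end

noncomputable section

namespace RISCSMA

/-! Charge every unit of time a price `lam`, so that maximising E[Y]/E[T] becomes a question about
the sign of E[Y] - `lam` E[T]. Contentions are independent and identically distributed, and a
rejected offer cannot be recalled. At the right price the net value of starting a further contention
is therefore zero, and continuing is worth 0 apart from probing costs already incurred. The best
mean net reward of one contention, not counting the contention itself, is then `meanGain lam`, and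
the price is right when this equals the mean contention cost `lam * τo`. The left side is antitone,
Lipschitz and positive at 0, while the right side is strictly increasing because `τo` is positive;
hence there is exactly one root, and it is positive (`exists_meanGain_eq`).

At this price no dynamic programming is needed, since optimality can be checked one contention at a
time. On every event determined by the earlier contentions, the mean reward of contention `n` is at
most `lam` times the mean time spent on it, with equality if the decisions follow the rule
(`setIntegral_step_le`). The event that the strategy is still running is such an event. Summing over
`n` compares E[Y] with `lam` E[T]; all terms are nonnegative, so the sums are taken in `ENNReal` and
finiteness of E[Y] is a consequence.

The probabilistic input is independence of blocks of primitive variables (`indep_block`). A decision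
made before probing cannot depend on the RIS coefficients of its contention (`info₁_le`), which
permits replacing the probed reward by its mean `Λ`. The channels seen at a contention are
independent of the past and have the same law at every contention (`setIntegral_contention`).

The rule is feasible because it stops at each contention with the same probability, independently of
the past. If that probability were zero, the first contention would earn nothing, contradicting the
equality case (`stopProb_pos`). -/

/-! ### Complex Gaussian amplitudes and phase alignment. -/

instance isProbabilityMeasure_complexGaussian (v : ℝ) :
    IsProbabilityMeasure (complexGaussian v) := by
  unfold complexGaussian
  refine Measure.isProbabilityMeasure_map (Measurable.aemeasurable ?_)
  exact Complex.measurableEquivRealProd.symm.measurable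

theorem measurable_complex_mk : Measurable (fun z : ℝ × ℝ => (⟨z.1, z.2⟩ : ℂ)) :=
  Complex.measurableEquivRealProd.symm.measurable

theorem integrable_norm_complexGaussian (v : ℝ) :
    Integrable (fun z : ℂ => ‖z‖) (complexGaussian v) := by
  unfold complexGaussian
  rw [integrable_map_measure (by fun_prop) measurable_complex_mk.aemeasurable]
  have h1 : Integrable (fun x : ℝ => |x|) (gaussianReal 0 (v / 2).toNNReal) :=
    ((memLp_id_gaussianReal 1).integrable (by simp)).abs
  refine Integrable.mono' ((h1.comp_fst _).add (h1.comp_snd _)) ?_ ?_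
  · exact (measurable_norm.comp measurable_complex_mk).aestronglyMeasurable
  · refine Filter.Eventually.of_forall fun z => ?_
    simpa using Complex.norm_le_abs_re_add_abs_im (⟨z.1, z.2⟩ : ℂ)

/-- The integrand is the radial density left over after passing to polar coordinates. Its primitive
`-exp(-r²/v)` is also correct for `v = 0`, where division by zero makes both sides vanish. -/
theorem integral_two_mul_exp_neg_sq (v x : ℝ) :
    ∫ r in (0 : ℝ)..x, 2 * r / v * Real.exp (-(r ^ 2 / v)) = 1 - Real.exp (-(x ^ 2 / v)) := by
  have hd : ∀ r ∈ Set.uIcc 0 x, HasDerivAt (fun r : ℝ => -Real.exp (-(r ^ 2 / v)))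
      (2 * r / v * Real.exp (-(r ^ 2 / v))) r := by
    intro r _
    have h1 : HasDerivAt (fun r : ℝ => -(r ^ 2 / v)) (-(2 * r / v)) r := by
      have := ((hasDerivAt_pow 2 r).div_const v).fun_neg
      simpa using this
    exact h1.exp.neg.congr_deriv (by ring)
  rw [intervalIntegral.integral_eq_sub_of_hasDerivAt hd]
  · simp; ring
  · exact Continuous.intervalIntegrable (by fun_prop) _ _

/-- Rotation invariance: the joint density sees only `a² + b²`, which makes polar coordinates
effective. -/
theorem gaussianPDFReal_mul_gaussianPDFReal {v : ℝ} (hv : 0 < v) (a b : ℝ) :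
    gaussianPDFReal 0 (v / 2).toNNReal a * gaussianPDFReal 0 (v / 2).toNNReal b =
      (Real.pi * v)⁻¹ * Real.exp (-((a ^ 2 + b ^ 2) / v)) := by
  have h2 : ((v / 2).toNNReal : ℝ) = v / 2 := Real.coe_toNNReal _ (by positivity)
  simp only [gaussianPDFReal, h2]
  have hs : 0 < Real.sqrt (2 * Real.pi * (v / 2)) := by positivity
  have : (Real.sqrt (2 * Real.pi * (v / 2)))⁻¹ * (Real.sqrt (2 * Real.pi * (v / 2)))⁻¹
      = (Real.pi * v)⁻¹ := by
    rw [← mul_inv, Real.mul_self_sqrt (by positivity)]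
    ring_nf
  rw [mul_mul_mul_comm, this, ← Real.exp_add]
  congr 2
  field_simp
  ring

/-- The amplitude of a circularly symmetric complex Gaussian is Rayleigh distributed. -/
theorem complexGaussian_real_norm_le {v x : ℝ} (hv : 0 < v) (hx : 0 ≤ x) :
    ((complexGaussian v).map (fun z => ‖z‖)).real (Set.Iic x) =
      1 - Real.exp (-(x ^ 2 / v)) := by
  have hv2 : (v / 2).toNNReal ≠ 0 := by
    rw [Ne, Real.toNNReal_eq_zero, not_le]; positivity
  have hnn : ∀ r : ℝ, 0 ≤ r → 0 ≤ 2 * r / v * Real.exp (-(r ^ 2 / v)) := fun r hr => by positivity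
  have key : ((complexGaussian v).map (fun z => ‖z‖)) (Set.Iic x) =
      ENNReal.ofReal (1 - Real.exp (-(x ^ 2 / v))) := by
    rw [Measure.map_apply measurable_norm measurableSet_Iic, complexGaussian,
      Measure.map_apply measurable_complex_mk (measurable_norm measurableSet_Iic),
      gaussianReal_of_var_ne_zero _ hv2,
      prod_withDensity (measurable_gaussianPDF _ _) (measurable_gaussianPDF _ _)]
    have hmeas : MeasurableSet
        ((fun z : ℝ × ℝ => (⟨z.1, z.2⟩ : ℂ)) ⁻¹' ((fun z => ‖z‖) ⁻¹' Set.Iic x)) :=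
      measurable_complex_mk (measurable_norm measurableSet_Iic)
    rw [withDensity_apply _ hmeas, ← Measure.volume_eq_prod, ← lintegral_indicator hmeas,
      ← lintegral_comp_polarCoord_symm, polarCoord_target]
    -- The Jacobian times the density splits into the truncated Rayleigh density of the radius and
    -- the uniform density `1/(2π)` of the angle. The latter integrates to 1 over `(-π, π)`.
    have heq : ∀ p ∈ Set.Ioi (0 : ℝ) ×ˢ Set.Ioo (-Real.pi) Real.pi,
        ENNReal.ofReal p.1 • ((fun z : ℝ × ℝ => (⟨z.1, z.2⟩ : ℂ)) ⁻¹'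
          ((fun z => ‖z‖) ⁻¹' Set.Iic x)).indicator (fun z : ℝ × ℝ =>
            gaussianPDF 0 (v / 2).toNNReal z.1 * gaussianPDF 0 (v / 2).toNNReal z.2)
            (polarCoord.symm p) =
        (Set.Iic x).indicator (fun r => ENNReal.ofReal
          (2 * r / v * Real.exp (-(r ^ 2 / v)))) p.1 * ENNReal.ofReal (2 * Real.pi)⁻¹ := by
      rintro ⟨r, θ⟩ ⟨hr, -⟩
      have hr : 0 < r := hr
      have hnorm : ‖(⟨r * Real.cos θ, r * Real.sin θ⟩ : ℂ)‖ = r := by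
        rw [Complex.norm_def, Complex.normSq_mk,
          show r * Real.cos θ * (r * Real.cos θ) + r * Real.sin θ * (r * Real.sin θ) =
            r ^ 2 * (Real.cos θ ^ 2 + Real.sin θ ^ 2) by ring, Real.cos_sq_add_sin_sq, mul_one,
          Real.sqrt_sq hr.le]
      simp only [polarCoord_symm_apply, smul_eq_mul]
      by_cases hrx : r ≤ x
      · rw [Set.indicator_of_mem (by simpa [hnorm] using hrx), Set.indicator_of_mem (by exact hrx)]
        simp only [gaussianPDF]
        rw [← ENNReal.ofReal_mul (gaussianPDFReal_nonneg _ _ _),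
          gaussianPDFReal_mul_gaussianPDFReal hv, ← ENNReal.ofReal_mul hr.le,
          ← ENNReal.ofReal_mul (by positivity),
          show (r * Real.cos θ) ^ 2 + (r * Real.sin θ) ^ 2 =
            r ^ 2 * (Real.cos θ ^ 2 + Real.sin θ ^ 2) by ring, Real.cos_sq_add_sin_sq, mul_one]
        congr 1
        have := Real.pi_pos
        field_simp
      · rw [Set.indicator_of_notMem (by simpa [hnorm] using hrx),
          Set.indicator_of_notMem (by exact hrx)]
        simp
    rw [setLIntegral_congr_fun (measurableSet_Ioi.prod measurableSet_Ioo) heq,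
      Measure.volume_eq_prod, ← Measure.prod_restrict,
      lintegral_prod_mul (f := (Set.Iic x).indicator (fun r => ENNReal.ofReal
          (2 * r / v * Real.exp (-(r ^ 2 / v))))) (g := fun _ => ENNReal.ofReal (2 * Real.pi)⁻¹)
        (by fun_prop (disch := measurability)) (by fun_prop),
      lintegral_indicator measurableSet_Iic, Measure.restrict_restrict measurableSet_Iic,
      Set.inter_comm, Set.Ioi_inter_Iic]
    rw [setLIntegral_const, Real.volume_Ioo, ← ENNReal.ofReal_mul (by positivity),
      show (2 * Real.pi)⁻¹ * (Real.pi - -Real.pi) = 1 by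
        have := Real.pi_pos
        field_simp; ring,
      ENNReal.ofReal_one, mul_one, ← ofReal_integral_eq_lintegral_ofReal,
      ← intervalIntegral.integral_of_le hx, integral_two_mul_exp_neg_sq v x]
    · exact ((Continuous.intervalIntegrable (by fun_prop) 0 x).1)
    · exact (ae_restrict_iff' measurableSet_Ioc).2
        (Filter.Eventually.of_forall fun r hr => hnn r hr.1.le)
  rw [measureReal_def, key, ENNReal.toReal_ofReal]
  rw [sub_nonneg, Real.exp_le_one_iff]
  have : 0 ≤ x ^ 2 / v := by positivity
  linarith

/-- A sum of complex numbers is longest when all summands have the same argument. -/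
theorem optPhase_exp {M : ℕ} (h : ℂ) (f g : Fin M → ℂ) (m : Fin M) :
    f m * (Complex.exp (optPhase h f g m * Complex.I) * g m) =
      ‖f m * g m‖ * Complex.exp (h.arg * Complex.I) := by
  -- Reduction to `[0, 2π)` subtracts a multiple of `2π`, which the exponential does not see.
  obtain ⟨k, hk⟩ : ∃ k : ℤ, optPhase h f g m = (h.arg - (f m * g m).arg) - k * (2 * Real.pi) := by
    refine ⟨toIcoDiv Real.two_pi_pos 0 (h.arg - (f m * g m).arg), ?_⟩
    rw [optPhase, toIcoMod, zsmul_eq_mul]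
  have hexp : Complex.exp (optPhase h f g m * Complex.I) =
      Complex.exp ((h.arg - (f m * g m).arg : ℝ) * Complex.I) := by
    rw [hk, Complex.exp_eq_exp_iff_exists_int]
    exact ⟨-k, by push_cast; ring⟩
  calc f m * (Complex.exp (optPhase h f g m * Complex.I) * g m)
      = (f m * g m) * Complex.exp (optPhase h f g m * Complex.I) := by ring
    _ = (‖f m * g m‖ * Complex.exp ((f m * g m).arg * Complex.I)) *
          Complex.exp ((h.arg - (f m * g m).arg : ℝ) * Complex.I) := by
        rw [Complex.norm_mul_exp_arg_mul_I, hexp]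
    _ = _ := by
        rw [mul_assoc, ← Complex.exp_add]
        congr 2
        push_cast
        ring

/-! ### Rates, their integrability, and the value of probing. -/

namespace Params

variable {K M : ℕ} (c : Params K M)

theorem ρ_pos : 0 < c.ρ := by
  have := c.Pt_pos; have := c.Gt_pos; have := c.Gr_pos; have := c.β₀_pos; have := c.N₀_pos
  unfold ρ; positivity

theorem τM1_pos : 0 < c.τM1 := add_pos c.τR_pos c.τC_pos

theorem τM2_le_τd : c.τM2 ≤ c.τd := c.probing_le

theorem τM2_eq : c.τM2 = c.τM1 + (c.τp + c.τC) := by unfold τM2; ring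

theorem τM1_lt_τd : c.τM1 < c.τd := by
  have := c.τM2_le_τd; have := c.τM2_eq; have := c.τC_pos; have := c.τp_pos
  linarith

theorem one_le_one_add_sq (u : ℝ) : 1 ≤ 1 + c.ρ * u ^ 2 := by
  have := c.ρ_pos
  have : 0 ≤ c.ρ * u ^ 2 := by positivity
  linarith

theorem rateD_nonneg (x : ℝ) : 0 ≤ c.rateD x :=
  Real.logb_nonneg one_lt_two (c.one_le_one_add_sq x)

theorem rateR_nonneg (x : ℝ) (q : Fin M → ℂ) : 0 ≤ c.rateR x q :=
  Real.logb_nonneg one_lt_two (c.one_le_one_add_sq _)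

theorem rateD_pos {x : ℝ} (hx : x ≠ 0) : 0 < c.rateD x := by
  refine Real.logb_pos one_lt_two ?_
  have := c.ρ_pos
  have : 0 < c.ρ * x ^ 2 := by positivity
  linarith

/-- From `1 + ρu² ≤ (1 + √ρ|u|)²` and `log(1 + s) ≤ s`. Linear growth means that first moments of
the amplitudes suffice for integrability of all rates. -/
theorem exists_logb_le : ∃ C, 0 ≤ C ∧ ∀ u : ℝ, Real.logb 2 (1 + c.ρ * u ^ 2) ≤ C * |u| := by
  refine ⟨2 * √c.ρ / Real.log 2, by positivity, fun u => ?_⟩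
  have h0 : 0 ≤ √c.ρ * |u| := by positivity
  have h1 : 1 + c.ρ * u ^ 2 ≤ (1 + √c.ρ * |u|) ^ 2 := by
    have : (√c.ρ * |u|) ^ 2 = c.ρ * u ^ 2 := by
      rw [mul_pow, Real.sq_sqrt c.ρ_pos.le, sq_abs]
    nlinarith
  have h2 : Real.log (1 + c.ρ * u ^ 2) ≤ 2 * (√c.ρ * |u|) := by
    calc Real.log (1 + c.ρ * u ^ 2) ≤ Real.log ((1 + √c.ρ * |u|) ^ 2) :=
          Real.log_le_log (by linarith [c.one_le_one_add_sq u]) h1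
      _ = 2 * Real.log (1 + √c.ρ * |u|) := by rw [Real.log_pow]; norm_cast
      _ ≤ 2 * (√c.ρ * |u|) := by
          have := Real.log_le_sub_one_of_pos (show 0 < 1 + √c.ρ * |u| by linarith)
          linarith
  rw [Real.logb, div_mul_eq_mul_div]
  gcongr
  linarith

@[fun_prop]
theorem measurable_rateD : Measurable c.rateD := by
  unfold rateD Real.logb; fun_prop

@[fun_prop]
theorem measurable_rateR : Measurable (fun z : ℝ × (Fin M → ℂ) => c.rateR z.1 z.2) := by
  unfold rateR Real.logb; fun_prop

theorem measurable_direct (lam : ℝ) : Measurable (c.direct lam) := by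
  unfold direct; fun_prop

theorem measurable_probed (lam : ℝ) :
    Measurable (fun z : ℝ × (Fin M → ℂ) => c.probed lam z.1 z.2) := by
  unfold probed; fun_prop

/-- Cascaded coefficients of the two hops. -/
def cascade (y : (Fin M → ℂ) × (Fin M → ℂ)) : Fin M → ℂ := fun m => y.1 m * y.2 m

theorem measurable_cascade : Measurable (cascade (M := M)) := by
  unfold cascade; fun_prop

theorem measurable_probed_cascade (lam : ℝ) : Measurable
    (fun z : ℝ × ((Fin M → ℂ) × (Fin M → ℂ)) => c.probed lam z.1 (cascade z.2)) := by
  have h : Measurable (fun z : ℝ × ((Fin M → ℂ) × (Fin M → ℂ)) => (z.1, cascade z.2)) :=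
    measurable_fst.prodMk (measurable_cascade.comp measurable_snd)
  have h2 := (c.measurable_probed lam).comp h
  simpa only [Function.comp_def] using h2

instance (k : Fin K) : IsProbabilityMeasure (c.lawH k) := by unfold lawH; infer_instance
instance (k : Fin K) : IsProbabilityMeasure (c.lawF k) := by unfold lawF; infer_instance
instance (k : Fin K) : IsProbabilityMeasure (c.lawG k) := by unfold lawG; infer_instance
instance (k : Fin K) : IsProbabilityMeasure (c.lawFG k) := by unfold lawFG; infer_instance
instance (k : Fin K) : IsProbabilityMeasure (c.lawAbsH k) := by
  unfold lawAbsH; exact Measure.isProbabilityMeasure_map measurable_norm.aemeasurable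

theorem lawAbsH_real_Iic (k : Fin K) {x : ℝ} (hx : 0 ≤ x) :
    (c.lawAbsH k).real (Set.Iic x) = 1 - Real.exp (-(x ^ 2 / c.d k ^ (-c.α₁))) :=
  complexGaussian_real_norm_le (Real.rpow_pos_of_pos (c.d_pos k) _) hx

/-- The Rayleigh distribution function vanishes at 0. -/
theorem ae_pos_lawAbsH (k : Fin K) : ∀ᵐ x ∂c.lawAbsH k, 0 < x := by
  have h := c.lawAbsH_real_Iic k le_rfl
  simp only [ne_eq, OfNat.ofNat_ne_zero, not_false_eq_true, zero_pow, zero_div, neg_zero,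
    Real.exp_zero, sub_self] at h
  rw [measureReal_eq_zero_iff] at h
  rw [ae_iff]
  convert h using 2
  ext; simp

/-- Reconciles the fixed-point equation, which integrates over `[0, ∞)`, with laws of observations
on the whole line. -/
theorem lawAbsH_restrict_Ici (k : Fin K) : (c.lawAbsH k).restrict (Set.Ici 0) = c.lawAbsH k :=
  Measure.restrict_eq_self_of_ae_mem ((c.ae_pos_lawAbsH k).mono fun _ h => h.le)

/-- The hops are independent, so first moments of the two factors give a first moment of the
product. -/
theorem integrable_norm_cascade (k : Fin K) (m : Fin M) :
    Integrable (fun y => ‖cascade y m‖) (c.lawFG k) := by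
  have h1 : Integrable (fun x : Fin M → ℂ => ‖x m‖) (Measure.pi fun _ : Fin M => c.lawF k) :=
    (measurePreserving_eval (fun _ : Fin M => c.lawF k) m).integrable_comp_of_integrable
      (integrable_norm_complexGaussian _)
  have h2 : Integrable (fun x : Fin M → ℂ => ‖x m‖) (Measure.pi fun _ : Fin M => c.lawG k) :=
    (measurePreserving_eval (fun _ : Fin M => c.lawG k) m).integrable_comp_of_integrable
      (integrable_norm_complexGaussian _)
  simpa [cascade, lawFG] using h1.mul_prod h2

theorem integrable_abs_lawAbsH (k : Fin K) : Integrable (fun x : ℝ => |x|) (c.lawAbsH k) := by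
  unfold lawAbsH
  rw [integrable_map_measure (by fun_prop) (by fun_prop)]
  simpa [Function.comp_def, lawH] using integrable_norm_complexGaussian (c.d k ^ (-c.α₁))

/-- The amplitude and the coefficients are arbitrary functions here, so that one bound serves a
fixed amplitude, the joint law of the channels, and, with `Q = 0`, the direct link. -/
theorem integrable_rateR {α : Type*} [MeasurableSpace α] {μ : Measure α} {X : α → ℝ}
    {Q : α → Fin M → ℂ} (hX : Measurable X) (hQ : Measurable Q)
    (hXi : Integrable (fun a => |X a|) μ) (hQi : ∀ m, Integrable (fun a => ‖Q a m‖) μ) :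
    Integrable (fun a => c.rateR (X a) (Q a)) μ := by
  obtain ⟨C, hC, hle⟩ := c.exists_logb_le
  refine Integrable.mono'
    ((hXi.add (integrable_finsetSum Finset.univ fun m _ => hQi m)).const_mul C)
    (c.measurable_rateR.comp (hX.prodMk hQ)).aestronglyMeasurable
    (Filter.Eventually.of_forall fun a => ?_)
  rw [Real.norm_of_nonneg (c.rateR_nonneg _ _)]
  refine (hle _).trans ?_
  gcongr
  simp only [Pi.add_apply]
  refine (abs_add_le _ _).trans ?_
  rw [abs_of_nonneg (Finset.sum_nonneg fun m _ => norm_nonneg (Q a m))]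

theorem integrable_rateD {α : Type*} [MeasurableSpace α] {μ : Measure α} {X : α → ℝ}
    (hX : Measurable X) (hXi : Integrable (fun a => |X a|) μ) :
    Integrable (fun a => c.rateD (X a)) μ := by
  simpa [rateR, rateD] using c.integrable_rateR (Q := fun _ _ => 0) hX (by fun_prop) hXi (by simp)

theorem integrable_probed_comp {α : Type*} [MeasurableSpace α] {μ : Measure α} [IsFiniteMeasure μ]
    {X : α → ℝ} {Q : α → Fin M → ℂ} (lam : ℝ) (hX : Measurable X) (hQ : Measurable Q)
    (hXi : Integrable (fun a => |X a|) μ) (hQi : ∀ m, Integrable (fun a => ‖Q a m‖) μ) :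
    Integrable (fun a => c.probed lam (X a) (Q a)) μ :=
  (((c.integrable_rateR hX hQ hXi hQi).const_mul _).sub (integrable_const _)).sup
    (integrable_const _)

theorem integrable_probed (k : Fin K) (lam x : ℝ) :
    Integrable (fun y => c.probed lam x (cascade y)) (c.lawFG k) :=
  c.integrable_probed_comp lam measurable_const measurable_cascade (integrable_const _)
    (c.integrable_norm_cascade k)

theorem integrable_probed_prod (k : Fin K) (lam : ℝ) :
    Integrable (fun z : ℝ × ((Fin M → ℂ) × (Fin M → ℂ)) => c.probed lam z.1 (cascade z.2))
      ((c.lawAbsH k).prod (c.lawFG k)) :=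
  c.integrable_probed_comp lam measurable_fst (measurable_cascade.comp measurable_snd)
    ((c.integrable_abs_lawAbsH k).comp_fst _) (fun m => (c.integrable_norm_cascade k m).comp_snd _)

theorem Λ_eq (k : Fin K) (lam x : ℝ) :
    c.Λ k lam x = ∫ y, c.probed lam x (cascade y) ∂(c.lawFG k) := rfl

theorem measurable_Λ (k : Fin K) (lam : ℝ) : Measurable (c.Λ k lam) :=
  ((c.measurable_probed_cascade lam).stronglyMeasurable.integral_prod_right
    (ν := c.lawFG k)).measurable

theorem integrable_Λ (k : Fin K) (lam : ℝ) : Integrable (c.Λ k lam) (c.lawAbsH k) :=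
  (c.integrable_probed_prod k lam).integral_prod_left

theorem integrable_direct (k : Fin K) (lam : ℝ) : Integrable (c.direct lam) (c.lawAbsH k) :=
  ((c.integrable_rateD measurable_id (c.integrable_abs_lawAbsH k)).sub
    (integrable_const lam)).const_mul _

theorem measurable_gain (k : Fin K) (lam : ℝ) : Measurable (c.gain k lam) :=
  ((c.measurable_direct lam).max (c.measurable_Λ k lam)).max measurable_const

theorem integrable_gain (k : Fin K) (lam : ℝ) : Integrable (c.gain k lam) (c.lawAbsH k) :=
  ((c.integrable_direct k lam).sup (c.integrable_Λ k lam)).sup (integrable_const 0)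

theorem gain_nonneg (k : Fin K) (lam x : ℝ) : 0 ≤ c.gain k lam x := le_max_right _ _

/-- The rate is maximal when all reflected signals are in phase with the direct one. -/
theorem ratePhase_optPhase (h : ℂ) (f g : Fin M → ℂ) :
    c.ratePhase (optPhase h f g) h f g = c.rateR ‖h‖ (fun m => f m * g m) := by
  unfold ratePhase rateR
  have : h + f ⬝ᵥ Matrix.mulVec (Matrix.diagonal fun m =>
      Complex.exp (optPhase h f g m * Complex.I)) g =
      ((‖h‖ + ∑ m, ‖f m * g m‖ : ℝ) : ℂ) * Complex.exp (h.arg * Complex.I) := by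
    simp only [dotProduct, Matrix.mulVec_diagonal, optPhase_exp]
    push_cast
    rw [add_mul, Complex.norm_mul_exp_arg_mul_I, Finset.sum_mul]
  rw [this, norm_mul, Complex.norm_exp_ofReal_mul_I, mul_one, Complex.norm_real,
    Real.norm_of_nonneg (by positivity)]

/-- Triangle inequality: the phase factors have modulus one. -/
theorem ratePhase_le (φ : Fin M → ℝ) (h : ℂ) (f g : Fin M → ℂ) :
    c.ratePhase φ h f g ≤ c.rateR ‖h‖ (fun m => f m * g m) := by
  unfold ratePhase rateR
  have := c.ρ_pos
  refine Real.logb_le_logb_of_le one_lt_two (by positivity) ?_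
  gcongr
  refine (norm_add_le _ _).trans ?_
  gcongr
  simp only [dotProduct, Matrix.mulVec_diagonal]
  refine (norm_sum_le _ _).trans (le_of_eq (Finset.sum_congr rfl fun m _ => ?_))
  rw [norm_mul, norm_mul, Complex.norm_exp_ofReal_mul_I, one_mul, norm_mul]

/-! ### Monotone and Lipschitz dependence on the price. -/

theorem direct_antitone {lam mu : ℝ} (h : lam ≤ mu) (x : ℝ) : c.direct mu x ≤ c.direct lam x := by
  have := c.τM1_lt_τd
  unfold direct
  exact mul_le_mul_of_nonneg_left (by linarith) (by linarith)

theorem direct_le_add {lam mu : ℝ} (x : ℝ) :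
    c.direct lam x = c.direct mu x + (c.τd - c.τM1) * (mu - lam) := by
  unfold direct; ring

theorem probed_antitone {lam mu : ℝ} (h : lam ≤ mu) (x : ℝ) (q : Fin M → ℂ) :
    c.probed mu x q ≤ c.probed lam x q := by
  have := c.τM1_lt_τd; have := c.τC_pos; have := c.τp_pos
  unfold probed
  refine max_le_max ?_ ?_ <;> nlinarith

/-- The two branches have slopes `-(τd - τM1)` and `-(τp + τC)` in the price, and `τp + τC = τM2 -
τM1 ≤ τd - τM1`. This common Lipschitz constant survives expectations, maxima and the average over
winners. -/
theorem probed_le_add {lam mu : ℝ} (h : lam ≤ mu) (x : ℝ) (q : Fin M → ℂ) :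
    c.probed lam x q ≤ c.probed mu x q + (c.τd - c.τM1) * (mu - lam) := by
  have := c.τM2_le_τd; have := c.τM2_eq
  unfold probed
  rw [← max_add_add_right]
  refine max_le_max ?_ ?_ <;> nlinarith

theorem Λ_antitone (k : Fin K) {lam mu : ℝ} (h : lam ≤ mu) (x : ℝ) : c.Λ k mu x ≤ c.Λ k lam x :=
  integral_mono (c.integrable_probed k mu x) (c.integrable_probed k lam x)
    fun _ => c.probed_antitone h x _

theorem Λ_le_add (k : Fin K) {lam mu : ℝ} (h : lam ≤ mu) (x : ℝ) :
    c.Λ k lam x ≤ c.Λ k mu x + (c.τd - c.τM1) * (mu - lam) := by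
  have h1 : ∫ y, (c.probed mu x (cascade y) + (c.τd - c.τM1) * (mu - lam)) ∂(c.lawFG k) =
      c.Λ k mu x + (c.τd - c.τM1) * (mu - lam) := by
    rw [integral_add (c.integrable_probed k mu x) (integrable_const _), ← c.Λ_eq]
    simp
  rw [← h1]
  exact integral_mono (c.integrable_probed k lam x)
    ((c.integrable_probed k mu x).add (integrable_const _)) fun y => c.probed_le_add h x _

theorem gain_antitone (k : Fin K) {lam mu : ℝ} (h : lam ≤ mu) (x : ℝ) :
    c.gain k mu x ≤ c.gain k lam x :=
  max_le_max (max_le_max (c.direct_antitone h x) (c.Λ_antitone k h x)) le_rfl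

theorem gain_le_add (k : Fin K) {lam mu : ℝ} (h : lam ≤ mu) (x : ℝ) :
    c.gain k lam x ≤ c.gain k mu x + (c.τd - c.τM1) * (mu - lam) := by
  have h0 : 0 ≤ (c.τd - c.τM1) * (mu - lam) :=
    mul_nonneg (sub_nonneg.2 c.τM1_lt_τd.le) (sub_nonneg.2 h)
  unfold gain
  rw [← max_add_add_right, ← max_add_add_right]
  exact max_le_max (max_le_max (c.direct_le_add x).le (c.Λ_le_add k h x)) (by linarith)

/-! ### Averaging over the winner, and the root of the fixed-point equation. -/

theorem winProb_nonneg (k : Fin K) : 0 ≤ c.winProb k :=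
  div_nonneg (mul_nonneg (c.p_nonneg k) (Finset.prod_nonneg fun i _ => sub_nonneg.2 (c.p_le_one i)))
    c.ps_pos.le

theorem sum_winProb : ∑ k, c.winProb k = 1 := by
  unfold winProb
  rw [← Finset.sum_div]
  exact div_self c.ps_pos.ne'

theorem winProb_eq_of_forall_p_eq (h : ∀ i j, c.p i = c.p j) (k : Fin K) :
    c.winProb k = 1 / K := by
  have hw : ∀ j, c.winProb j = c.winProb k := by
    intro j
    unfold winProb
    congr 2
    · exact h j k
    · simp only [h _ k, Finset.prod_const, Finset.card_erase_of_mem (Finset.mem_univ _)]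
  have hs := c.sum_winProb
  simp only [hw, Finset.sum_const, Finset.card_univ, Fintype.card_fin, nsmul_eq_mul] at hs
  rw [eq_div_iff, mul_comm]
  · exact hs
  · rintro h0
    simp [h0] at hs

/-- Mean gain of a contention at price `lam`. -/
def meanGain (lam : ℝ) : ℝ := ∑ k, c.winProb k * ∫ x, c.gain k lam x ∂(c.lawAbsH k)

theorem sum_winProb_setIntegral (lam : ℝ) :
    ∑ k, c.winProb k * (∫ x in Set.Ici 0, c.gain k lam x ∂(c.lawAbsH k)) = c.meanGain lam := by
  simp only [lawAbsH_restrict_Ici, meanGain]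

theorem meanGain_antitone : Antitone c.meanGain := by
  intro lam mu h
  refine Finset.sum_le_sum fun k _ => mul_le_mul_of_nonneg_left ?_ (c.winProb_nonneg k)
  exact integral_mono (c.integrable_gain k mu) (c.integrable_gain k lam)
    fun x => c.gain_antitone k h x

theorem meanGain_le_add {lam mu : ℝ} (h : lam ≤ mu) :
    c.meanGain lam ≤ c.meanGain mu + (c.τd - c.τM1) * (mu - lam) := by
  have h1 : c.meanGain mu + (c.τd - c.τM1) * (mu - lam) = ∑ k, c.winProb k *
      ((∫ x, c.gain k mu x ∂(c.lawAbsH k)) + (c.τd - c.τM1) * (mu - lam)) := by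
    simp only [mul_add, Finset.sum_add_distrib, meanGain]
    rw [← Finset.sum_mul, c.sum_winProb, one_mul]
  rw [h1]
  refine Finset.sum_le_sum fun k _ => mul_le_mul_of_nonneg_left ?_ (c.winProb_nonneg k)
  have h2 : ∫ x, (c.gain k mu x + (c.τd - c.τM1) * (mu - lam)) ∂(c.lawAbsH k) =
      (∫ x, c.gain k mu x ∂(c.lawAbsH k)) + (c.τd - c.τM1) * (mu - lam) := by
    rw [integral_add (c.integrable_gain k mu) (integrable_const _)]
    simp
  rw [← h2]
  exact integral_mono (c.integrable_gain k lam)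
    ((c.integrable_gain k mu).add (integrable_const _)) fun x => c.gain_le_add k h x

theorem continuous_meanGain : Continuous c.meanGain := by
  have hL := sub_nonneg.2 c.τM1_lt_τd.le
  refine (LipschitzWith.of_dist_le_mul (K := ⟨c.τd - c.τM1, hL⟩) fun lam mu => ?_).continuous
  rw [Real.dist_eq, Real.dist_eq]
  change _ ≤ (c.τd - c.τM1) * _
  rcases le_total lam mu with h | h
  · have h1 := c.meanGain_antitone h
    have h2 := c.meanGain_le_add h
    rw [abs_of_nonneg (by linarith), abs_of_nonpos (by linarith)]
    linarith
  · have h1 := c.meanGain_antitone h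
    have h2 := c.meanGain_le_add h
    rw [abs_of_nonpos (by linarith), abs_of_nonneg (by linarith)]
    linarith

/-- At price zero the direct link already pays a positive amount almost surely, and some weight is
positive because the weights sum to one. -/
theorem meanGain_zero_pos : 0 < c.meanGain 0 := by
  have hpos : ∀ k, 0 < ∫ x, c.gain k 0 x ∂(c.lawAbsH k) := by
    intro k
    rw [integral_pos_iff_support_of_nonneg (c.gain_nonneg k 0) (c.integrable_gain k 0)]
    have : (Function.support (c.gain k 0)) =ᵐ[c.lawAbsH k] Set.univ := by
      rw [Filter.eventuallyEq_univ]
      filter_upwards [c.ae_pos_lawAbsH k] with x hx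
      have hd : 0 < c.direct 0 x := by
        unfold direct
        rw [sub_zero]
        exact mul_pos (sub_pos.2 c.τM1_lt_τd) (c.rateD_pos hx.ne')
      exact (lt_of_lt_of_le hd ((le_max_left _ _).trans (le_max_left _ _))).ne'
    rw [measure_congr this]
    simp
  obtain ⟨k, -, hk⟩ : ∃ k ∈ Finset.univ, 0 < c.winProb k :=
    Finset.exists_lt_of_sum_lt (f := fun _ => (0 : ℝ)) (by simp [c.sum_winProb])
  exact Finset.sum_pos' (fun k _ => mul_nonneg (c.winProb_nonneg k) (hpos k).le)
    ⟨k, Finset.mem_univ _, mul_pos hk (hpos k)⟩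

/-- The fixed-point equation has exactly one root, and it is positive. -/
theorem exists_meanGain_eq (hτ : 0 < c.τo) :
    ∃ lamStar, 0 < lamStar ∧ ∀ lam, c.meanGain lam = lam * c.τo ↔ lam = lamStar := by
  have hmono : ∀ {lam mu : ℝ}, lam < mu →
      c.meanGain mu - mu * c.τo < c.meanGain lam - lam * c.τo := by
    intro lam mu h
    have := c.meanGain_antitone h.le
    nlinarith
  have hcont : Continuous fun lam => c.meanGain lam - lam * c.τo :=
    c.continuous_meanGain.sub (by fun_prop)
  have h0 := c.meanGain_zero_pos
  -- The right end for the intermediate value theorem: `meanGain b ≤ meanGain 0 = b * τo`.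
  set b := c.meanGain 0 / c.τo with hb
  have hb0 : 0 < b := div_pos h0 hτ
  have hbneg : c.meanGain b - b * c.τo ≤ 0 := by
    have := c.meanGain_antitone hb0.le
    rw [hb, div_mul_cancel₀ _ hτ.ne', ← hb]
    linarith
  obtain ⟨r, hr, hroot⟩ := intermediate_value_Icc' hb0.le hcont.continuousOn
    (show (0 : ℝ) ∈ Set.Icc _ _ from ⟨hbneg, by simpa using h0.le⟩)
  simp only at hroot
  refine ⟨r, lt_of_le_of_ne hr.1 ?_, fun lam => ⟨fun h => ?_, ?_⟩⟩
  · rintro rfl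
    simp at hroot
    linarith
  · rcases lt_trichotomy lam r with hlt | heq | hlt
    · have := hmono hlt; linarith
    · exact heq
    · have := hmono hlt; linarith
  · rintro rfl
    linarith

end Params

/-! ### Measurability of randomly indexed values and of first hitting indices. -/

section Measurability

variable {Ω ι E : Type*} {mΩ : MeasurableSpace Ω} [MeasurableSpace E]

theorem measurable_eval_countable [Countable ι] [MeasurableSpace ι] [MeasurableSingletonClass ι]
    {i : Ω → ι} {F : ι → Ω → E} (hi : Measurable i) (hF : ∀ j, Measurable (F j)) :
    Measurable fun ω => F (i ω) ω :=
  (measurable_from_prod_countable_left (f := fun z : Ω × ι => F z.2 z.1) hF).comp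
    (measurable_id.prodMk hi)

theorem measurable_sInf_nat {Q : ℕ → Ω → Prop} (hQ : ∀ s, MeasurableSet {ω | Q s ω}) :
    Measurable fun ω => sInf {s | Q s ω} := by
  refine measurable_to_countable' fun s => ?_
  -- The second alternative accounts for the infimum of the empty set, which is 0.
  have : (fun ω => sInf {s | Q s ω}) ⁻¹' {s} =
      {ω | (Q s ω ∧ ∀ j < s, ¬ Q j ω) ∨ (s = 0 ∧ ∀ j, ¬ Q j ω)} := by
    ext ω
    simp only [Set.mem_preimage, Set.mem_singleton_iff, Set.mem_ofPred_eq]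
    constructor
    · rintro rfl
      by_cases h : ∃ j, Q j ω
      · exact Or.inl ⟨Nat.sInf_mem (s := {s | Q s ω}) h, fun j hj => Nat.notMem_of_lt_sInf hj⟩
      · refine Or.inr ⟨?_, not_exists.1 h⟩
        rw [Nat.sInf_eq_zero]
        exact Or.inr (Set.eq_empty_iff_forall_notMem.2 (not_exists.1 h))
    · rintro (⟨h1, h2⟩ | ⟨rfl, h⟩)
      · exact le_antisymm (Nat.sInf_le h1) (not_lt.1 fun hlt =>
          h2 _ hlt (Nat.sInf_mem (s := {s | Q s ω}) ⟨s, h1⟩))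
      · rw [Nat.sInf_eq_zero]
        exact Or.inr (Set.eq_empty_iff_forall_notMem.2 h)
  rw [this]
  refine MeasurableSet.union ((hQ s).inter ?_) ((MeasurableSet.const _).inter ?_)
  · change MeasurableSet {ω | ∀ j < s, ¬ Q j ω}
    have : {ω | ∀ j < s, ¬ Q j ω} = ⋂ j, ⋂ _ : j < s, {ω | Q j ω}ᶜ := by ext; simp
    rw [this]
    exact MeasurableSet.iInter fun j => MeasurableSet.iInter fun _ => (hQ j).compl
  · change MeasurableSet {ω | ∀ j, ¬ Q j ω}
    have : {ω | ∀ j, ¬ Q j ω} = ⋂ j, {ω | Q j ω}ᶜ := by ext; simp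
    rw [this]
    exact MeasurableSet.iInter fun j => (hQ j).compl

theorem integrable_and_integral_eq {P : Measure Ω} {f : Ω → ℝ} {a : ℝ} (hf : Measurable f)
    (h0 : ∀ ω, 0 ≤ f ω) (ha : 0 ≤ a) (h : ∫⁻ ω, ENNReal.ofReal (f ω) ∂P = ENNReal.ofReal a) :
    Integrable f P ∧ ∫ ω, f ω ∂P = a := by
  have h0' : 0 ≤ᵐ[P] f := Filter.Eventually.of_forall h0
  refine ⟨(lintegral_ofReal_ne_top_iff_integrable hf.aestronglyMeasurable h0').1 (by simp [h]), ?_⟩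
  rw [integral_eq_lintegral_of_nonneg_ae h0' hf.aestronglyMeasurable, h, ENNReal.toReal_ofReal ha]

end Measurability

/-! ### Index sets of the primitive variables and their disjointness. -/

/-- Indices of the primitive random variables of a network. -/
abbrev Idx (K M : ℕ) : Type :=
  (ℕ × ℕ × Fin K) ⊕ (ℕ × Fin K) ⊕ (ℕ × Fin K × Fin M) ⊕ (ℕ × Fin K × Fin M)

namespace Idx

variable {K M : ℕ}

/-- The contention to which a primitive random variable belongs. -/
def time : Idx K M → ℕ :=
  Sum.elim (fun i => i.1) (Sum.elim (fun i => i.1) (Sum.elim (fun i => i.1) (fun i => i.1)))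

/-- RTS decisions in slot `s` of contention `n`. -/
def slot (n s : ℕ) : Set (Idx K M) := {i | ∃ k, i = .inl (n, s, k)}

/-- RTS decisions in the slots of contention `n` before slot `s`. -/
def slotsBefore (n s : ℕ) : Set (Idx K M) := {i | ∃ s' < s, ∃ k, i = .inl (n, s', k)}

/-- RTS decisions in contention `n`. -/
def sends (n : ℕ) : Set (Idx K M) := {i | ∃ s k, i = .inl (n, s, k)}

/-- Direct-link coefficients at contention `n`. -/
def direct (n : ℕ) : Set (Idx K M) := {i | ∃ k, i = .inr (.inl (n, k))}

/-- First-hop RIS coefficients at contention `n`. -/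
def hop₁ (n : ℕ) : Set (Idx K M) := {i | ∃ k m, i = .inr (.inr (.inl (n, k, m)))}

/-- Second-hop RIS coefficients at contention `n`. -/
def hop₂ (n : ℕ) : Set (Idx K M) := {i | ∃ k m, i = .inr (.inr (.inr (n, k, m)))}

/-- RIS coefficients at contention `n`. -/
def ris (n : ℕ) : Set (Idx K M) := hop₁ n ∪ hop₂ n

/-- Everything that belongs to the contentions before contention `n`. -/
def past (n : ℕ) : Set (Idx K M) := {i | time i < n}

/-- Everything that precedes the first decision at contention `n`. -/
def first (n : ℕ) : Set (Idx K M) := past n ∪ (sends n ∪ direct n)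

theorem past_mono {m n : ℕ} (h : m ≤ n) : (past m : Set (Idx K M)) ⊆ past n :=
  fun _ hi => lt_of_lt_of_le hi h

theorem slot_subset_sends (n s : ℕ) : (slot n s : Set (Idx K M)) ⊆ sends n := by
  rintro _ ⟨k, rfl⟩; exact ⟨s, k, rfl⟩

theorem sends_subset_past (n : ℕ) : (sends n : Set (Idx K M)) ⊆ past (n + 1) := by
  rintro _ ⟨s, k, rfl⟩; exact Nat.lt_succ_self n

theorem direct_subset_past (n : ℕ) : (direct n : Set (Idx K M)) ⊆ past (n + 1) := by
  rintro _ ⟨k, rfl⟩; exact Nat.lt_succ_self n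

theorem ris_subset_past (n : ℕ) : (ris n : Set (Idx K M)) ⊆ past (n + 1) := by
  rintro _ (⟨k, m, rfl⟩ | ⟨k, m, rfl⟩) <;> exact Nat.lt_succ_self n

theorem first_subset_past (n : ℕ) : (first n : Set (Idx K M)) ⊆ past (n + 1) :=
  Set.union_subset (past_mono (Nat.le_succ n))
    (Set.union_subset (sends_subset_past n) (direct_subset_past n))

theorem disjoint_slotsBefore_slot (n s : ℕ) :
    Disjoint (slotsBefore n s : Set (Idx K M)) (slot n s) := by
  rw [Set.disjoint_left]
  rintro _ ⟨s', hs, k, rfl⟩ ⟨k', h⟩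
  simp only [Sum.inl.injEq, Prod.mk.injEq] at h
  omega

theorem disjoint_sends_direct_ris (n : ℕ) :
    Disjoint (sends n : Set (Idx K M)) (direct n ∪ ris n) := by
  rw [Set.disjoint_left]
  rintro _ ⟨s, k, rfl⟩ (⟨k', h⟩ | ⟨k', m, h⟩ | ⟨k', m, h⟩) <;> simp at h

theorem disjoint_direct_ris (n : ℕ) : Disjoint (direct n : Set (Idx K M)) (ris n) := by
  rw [Set.disjoint_left]
  rintro _ ⟨k, rfl⟩ (⟨k', m, h⟩ | ⟨k', m, h⟩) <;> simp at h

theorem disjoint_hop₁_hop₂ (n : ℕ) : Disjoint (hop₁ n : Set (Idx K M)) (hop₂ n) := by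
  rw [Set.disjoint_left]
  rintro _ ⟨k, m, rfl⟩ ⟨k', m', h⟩
  simp at h

theorem disjoint_past {n : ℕ} {S : Set (Idx K M)} (hS : ∀ i ∈ S, time i = n) :
    Disjoint (past n) S := by
  rw [Set.disjoint_left]
  intro i hi hi'
  have hi : time i < n := hi
  exact hi.ne (hS i hi')

theorem time_sends {n : ℕ} : ∀ i ∈ (sends n : Set (Idx K M)), time i = n := by
  rintro _ ⟨s, k, rfl⟩; rfl

theorem time_direct {n : ℕ} : ∀ i ∈ (direct n : Set (Idx K M)), time i = n := by
  rintro _ ⟨k, rfl⟩; rfl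

theorem time_ris {n : ℕ} : ∀ i ∈ (ris n : Set (Idx K M)), time i = n := by
  rintro _ (⟨k, m, rfl⟩ | ⟨k, m, rfl⟩) <;> rfl

theorem disjoint_first_ris (n : ℕ) : Disjoint (first n : Set (Idx K M)) (ris n) := by
  rw [first, Set.disjoint_union_left, Set.disjoint_union_left]
  exact ⟨disjoint_past time_ris,
    (disjoint_sends_direct_ris n).mono_right Set.subset_union_right, disjoint_direct_ris n⟩

theorem disjoint_past_sends_direct_ris (n : ℕ) :
    Disjoint (past n ∪ sends n : Set (Idx K M)) (direct n ∪ ris n) := by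
  rw [Set.disjoint_union_left]
  refine ⟨?_, disjoint_sends_direct_ris n⟩
  rw [Set.disjoint_union_right]
  exact ⟨disjoint_past time_direct, disjoint_past time_ris⟩

end Idx

/-! ### Independent blocks and the contention process. -/

namespace Network

variable {K M : ℕ} {c : Params K M} {Ω : Type*} [mΩ : MeasurableSpace Ω] {P : Measure Ω}
variable (N : Network c P)

/-- The sigma-algebra of a primitive random variable. -/
@[reducible] def sig : Idx K M → MeasurableSpace Ω :=
  Sum.elim (fun i : ℕ × ℕ × Fin K => MeasurableSpace.comap (N.send i.1 i.2.1 i.2.2) inferInstance)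
    (Sum.elim (fun i : ℕ × Fin K => MeasurableSpace.comap (N.h i.1 i.2) inferInstance)
      (Sum.elim
        (fun i : ℕ × Fin K × Fin M => MeasurableSpace.comap (N.f i.1 i.2.1 i.2.2) inferInstance)
        (fun i : ℕ × Fin K × Fin M => MeasurableSpace.comap (N.g i.1 i.2.1 i.2.2) inferInstance)))

/-- The sigma-algebra of a family of primitive random variables. -/
@[reducible] def block (S : Set (Idx K M)) : MeasurableSpace Ω := ⨆ i ∈ S, N.sig i

theorem sig_le (i : Idx K M) : N.sig i ≤ mΩ := by
  rcases i with i | i | i | i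
  · exact (N.measurable_send _ _ _).comap_le
  · exact (N.measurable_h _ _).comap_le
  · exact (N.measurable_f _ _ _).comap_le
  · exact (N.measurable_g _ _ _).comap_le

theorem block_le (S : Set (Idx K M)) : N.block S ≤ mΩ := iSup₂_le fun i _ => N.sig_le i

theorem block_mono {S T : Set (Idx K M)} (h : S ⊆ T) : N.block S ≤ N.block T :=
  biSup_mono h

theorem sig_le_block {S : Set (Idx K M)} {i : Idx K M} (hi : i ∈ S) : N.sig i ≤ N.block S :=
  le_iSup₂ (f := fun i (_ : i ∈ S) => N.sig i) i hi

/-- Reduces independence of sigma-algebras to a statement about index sets; the later arguments that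
separate past, contention, direct link and RIS rest on it. -/
theorem indep_block {S T : Set (Idx K M)} (h : Disjoint S T) :
    Indep (N.block S) (N.block T) P :=
  indep_iSup_of_disjoint N.sig_le N.indep h

theorem measurable_send_block {S : Set (Idx K M)} {n s : ℕ} {k : Fin K}
    (h : (.inl (n, s, k) : Idx K M) ∈ S) : Measurable[N.block S] (N.send n s k) :=
  (comap_measurable _).mono (N.sig_le_block h) le_rfl

theorem measurable_h_block (n : ℕ) (k : Fin K) : Measurable[N.block (Idx.direct n)] (N.h n k) :=
  (comap_measurable _).mono
    (N.sig_le_block (i := .inr (.inl (n, k))) ⟨k, rfl⟩) le_rfl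

theorem measurable_f_block (n : ℕ) (k : Fin K) (m : Fin M) :
    Measurable[N.block (Idx.hop₁ n)] (N.f n k m) :=
  (comap_measurable _).mono
    (N.sig_le_block (i := .inr (.inr (.inl (n, k, m)))) ⟨k, m, rfl⟩) le_rfl

theorem measurable_g_block (n : ℕ) (k : Fin K) (m : Fin M) :
    Measurable[N.block (Idx.hop₂ n)] (N.g n k m) :=
  (comap_measurable _).mono
    (N.sig_le_block (i := .inr (.inr (.inr (n, k, m)))) ⟨k, m, rfl⟩) le_rfl

/-! ### A single slot -/

/-- In slot `s` of contention `n` nobody sends. -/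
def Idle (n s : ℕ) (ω : Ω) : Prop := ∀ k, N.send n s k ω = false

theorem measurableSet_sole (n s : ℕ) (k : Fin K) :
    MeasurableSet[N.block (Idx.slot n s)] {ω | N.Sole n s k ω} := by
  have hm : ∀ j, Measurable[N.block (Idx.slot n s)] (N.send n s j) :=
    fun j => N.measurable_send_block ⟨j, rfl⟩
  have : {ω | N.Sole n s k ω} = N.send n s k ⁻¹' {true} ∩
      ⋂ j, ⋂ _ : j ≠ k, N.send n s j ⁻¹' {false} := by
    ext; simp [Sole]
  rw [this]
  exact MeasurableSet.inter (hm k (measurableSet_singleton _))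
    (MeasurableSet.iInter fun j => MeasurableSet.iInter fun _ => hm j (measurableSet_singleton _))

theorem measurableSet_idle (n s : ℕ) :
    MeasurableSet[N.block (Idx.slot n s)] {ω | N.Idle n s ω} := by
  have hm : ∀ j, Measurable[N.block (Idx.slot n s)] (N.send n s j) :=
    fun j => N.measurable_send_block ⟨j, rfl⟩
  have : {ω | N.Idle n s ω} = ⋂ j, N.send n s j ⁻¹' {false} := by
    ext; simp [Idle]
  rw [this]
  exact MeasurableSet.iInter fun j => hm j (measurableSet_singleton _)

/-- In slot `s` of contention `n` exactly one source sends. -/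
def Success (n s : ℕ) (ω : Ω) : Prop := ∃ k, N.Sole n s k ω

theorem measurableSet_success (n s : ℕ) :
    MeasurableSet[N.block (Idx.slot n s)] {ω | N.Success n s ω} := by
  have : {ω | N.Success n s ω} = ⋃ k, {ω | N.Sole n s k ω} := by ext; simp [Success]
  rw [this]
  exact MeasurableSet.iUnion fun k => N.measurableSet_sole n s k

theorem Sole.unique {N : Network c P} {n s : ℕ} {k j : Fin K} {ω : Ω} (hk : N.Sole n s k ω)
    (hj : N.Sole n s j ω) : k = j := by
  by_contra hne
  have := hj.2 k hne
  simp [hk.1] at this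

theorem real_send_preimage [IsProbabilityMeasure P] (n s : ℕ) (k : Fin K) (b : Bool) :
    P.real (N.send n s k ⁻¹' {b}) = if b then c.p k else 1 - c.p k := by
  have ht : P.real (N.send n s k ⁻¹' {true}) = c.p k := by
    rw [measureReal_def]
    have : N.send n s k ⁻¹' {true} = {ω | N.send n s k ω = true} := rfl
    rw [this, N.law_send, ENNReal.toReal_ofReal (c.p_nonneg k)]
  cases b
  · have : N.send n s k ⁻¹' {false} = (N.send n s k ⁻¹' {true})ᶜ := by ext; simp
    rw [this, probReal_compl_eq_one_sub (N.measurable_send n s k (measurableSet_singleton _)), ht]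
    simp
  · simpa using ht

/-- An idle slot and a slot with sole sender `k` are both prescribed sending patterns, so one
product formula gives both probabilities. -/
theorem real_iInter_send_preimage [IsProbabilityMeasure P] (n s : ℕ) (b : Fin K → Bool) :
    P.real (⋂ k, N.send n s k ⁻¹' {b k}) = ∏ k, if b k then c.p k else 1 - c.p k := by
  have hinj : Function.Injective (fun k : Fin K => (.inl (n, s, k) : Idx K M)) := by
    intro i j h; simpa using h
  have := (N.indep.precomp hinj).meas_iInter (s := fun k => N.send n s k ⁻¹' {b k})
    (fun k => comap_measurable _ (measurableSet_singleton _))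
  rw [measureReal_def, this, ENNReal.toReal_prod]
  exact Finset.prod_congr rfl fun k _ => N.real_send_preimage n s k (b k)

theorem real_idle [IsProbabilityMeasure P] (n s : ℕ) :
    P.real {ω | N.Idle n s ω} = ∏ k, (1 - c.p k) := by
  have : {ω | N.Idle n s ω} = ⋂ j, N.send n s j ⁻¹' {(fun _ => false : Fin K → Bool) j} := by
    ext; simp [Idle]
  rw [this, real_iInter_send_preimage]
  simp

theorem real_sole [IsProbabilityMeasure P] (n s : ℕ) (k : Fin K) :
    P.real {ω | N.Sole n s k ω} = c.winProb k * c.ps := by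
  have : {ω | N.Sole n s k ω} =
      ⋂ j, N.send n s j ⁻¹' {(fun j => decide (j = k) : Fin K → Bool) j} := by
    ext ω
    simp only [Sole, Set.mem_ofPred_eq, Set.mem_iInter, Set.mem_preimage, Set.mem_singleton_iff]
    constructor
    · rintro ⟨h1, h2⟩ j
      by_cases hj : j = k
      · subst hj; simpa using h1
      · simpa [hj] using h2 j hj
    · intro h
      exact ⟨by simpa using h k, fun j hj => by simpa [hj] using h j⟩
  rw [this, real_iInter_send_preimage, Params.winProb,
    div_mul_cancel₀ _ (show c.ps ≠ 0 from c.ps_pos.ne'),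
    ← Finset.mul_prod_erase _ _ (Finset.mem_univ k)]
  congr 1
  · simp
  · refine Finset.prod_congr rfl fun j hj => ?_
    simp [Finset.ne_of_mem_erase hj]

theorem real_success [IsProbabilityMeasure P] (n s : ℕ) : P.real {ω | N.Success n s ω} = c.ps := by
  have : {ω | N.Success n s ω} = ⋃ k, {ω | N.Sole n s k ω} := by ext; simp [Success]
  rw [this, measureReal_iUnion_fintype _ fun k => N.block_le _ _ (N.measurableSet_sole n s k)]
  · simp_rw [real_sole, ← Finset.sum_mul, c.sum_winProb, one_mul]
  · intro i j hij
    exact Set.disjoint_left.2 fun ω hi hj => hij (Sole.unique hi hj)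

/-! ### The winner and the duration of a contention -/

/-- No slot before slot `s` is successful. -/
def Pending (n s : ℕ) (ω : Ω) : Prop := ∀ s' < s, ¬ N.Success n s' ω

theorem measurableSet_pending (n s : ℕ) :
    MeasurableSet[N.block (Idx.slotsBefore n s)] {ω | N.Pending n s ω} := by
  have : {ω | N.Pending n s ω} = ⋂ s', ⋂ _ : s' < s, {ω | N.Success n s' ω}ᶜ := by
    ext; simp [Pending]
  rw [this]
  refine MeasurableSet.iInter fun s' => MeasurableSet.iInter fun hs => MeasurableSet.compl ?_
  refine N.block_mono ?_ _ (N.measurableSet_success n s')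
  rintro _ ⟨k, rfl⟩
  exact ⟨s', hs, k, rfl⟩

theorem real_pending_inter (n s : ℕ) {A : Set Ω} (hA : MeasurableSet[N.block (Idx.slot n s)] A) :
    P.real ({ω | N.Pending n s ω} ∩ A) = P.real {ω | N.Pending n s ω} * P.real A := by
  simp only [measureReal_def]
  rw [(Indep_iff _ _ _).1 (N.indep_block (Idx.disjoint_slotsBefore_slot n s)) _ _
    (N.measurableSet_pending n s) hA, ENNReal.toReal_mul]

theorem real_pending [IsProbabilityMeasure P] (n s : ℕ) :
    P.real {ω | N.Pending n s ω} = (1 - c.ps) ^ s := by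
  induction s with
  | zero => simp [Pending]
  | succ s ih =>
    have : {ω | N.Pending n (s + 1) ω} = {ω | N.Pending n s ω} ∩ {ω | N.Success n s ω}ᶜ := by
      ext ω
      simp only [Pending, Nat.lt_succ_iff_lt_or_eq, Set.mem_ofPred_eq, Set.mem_inter_iff,
        Set.mem_compl_iff]
      grind
    rw [this, real_pending_inter _ _ _ (N.measurableSet_success n s).compl, ih,
      probReal_compl_eq_one_sub (N.block_le _ _ (N.measurableSet_success n s)), real_success,
      pow_succ]

theorem ps_le_one [IsProbabilityMeasure P] (N : Network c P) : c.ps ≤ 1 := by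
  rw [← N.real_success 0 0]
  exact measureReal_le_one

theorem one_sub_ps_mem [IsProbabilityMeasure P] (N : Network c P) : 0 ≤ 1 - c.ps ∧ 1 - c.ps < 1 :=
  ⟨sub_nonneg.2 N.ps_le_one, by have := c.ps_pos; unfold Params.ps; linarith⟩

theorem ae_exists_success [IsProbabilityMeasure P] (n : ℕ) : ∀ᵐ ω ∂P, ∃ s, N.Success n s ω := by
  rw [ae_iff, ← measureReal_eq_zero_iff]
  have hle : ∀ s, P.real {ω | ¬ ∃ s, N.Success n s ω} ≤ (1 - c.ps) ^ s := fun s => by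
    rw [← N.real_pending n s]
    exact measureReal_mono fun ω hω s' _ hs => hω ⟨s', hs⟩
  exact le_antisymm (ge_of_tendsto' (tendsto_pow_atTop_nhds_zero_of_lt_one N.one_sub_ps_mem.1
    N.one_sub_ps_mem.2) hle) measureReal_nonneg

theorem winSlot_eq_iff {n s : ℕ} {ω : Ω} (h : N.Success n s ω) :
    N.winSlot n ω = s ↔ N.Pending n s ω := by
  constructor
  · rintro rfl s' hs' h'
    exact Nat.notMem_of_lt_sInf (s := {s | ∃ k, N.Sole n s k ω}) hs' h'
  · intro hp
    exact le_antisymm (Nat.sInf_le h) (not_lt.1 fun hlt =>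
      hp _ hlt (Nat.sInf_mem (s := {s | ∃ k, N.Sole n s k ω}) ⟨s, h⟩))

/-- Identifies the slots that are paid for as failures. Existence of a success is essential:
otherwise `winSlot` takes the default value 0, while the right side holds for every `s`. -/
theorem lt_winSlot_iff {n s : ℕ} {ω : Ω} (h : ∃ s, N.Success n s ω) :
    s < N.winSlot n ω ↔ N.Pending n s ω ∧ ¬ N.Success n s ω := by
  constructor
  · intro hs
    exact ⟨fun s' hs' => Nat.notMem_of_lt_sInf (s := {s | ∃ k, N.Sole n s k ω}) (hs'.trans hs),
      Nat.notMem_of_lt_sInf (s := {s | ∃ k, N.Sole n s k ω}) hs⟩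
  · rintro ⟨hp, hs⟩
    have hmem : N.Success n (N.winSlot n ω) ω :=
      Nat.sInf_mem (s := {s | ∃ k, N.Sole n s k ω}) h
    by_contra hle
    rcases (not_lt.1 hle).lt_or_eq with hlt | heq
    · exact hp _ hlt hmem
    · exact hs (heq ▸ hmem)

theorem w_eq [NeZero K] {n s : ℕ} {k : Fin K} {ω : Ω} (h : N.Sole n s k ω) (hp : N.Pending n s ω) :
    N.w n ω = k := by
  have hs : N.winSlot n ω = s := (N.winSlot_eq_iff ⟨k, h⟩).2 hp
  have : N.Sole n (N.winSlot n ω) (N.w n ω) ω :=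
    Classical.epsilon_spec (p := fun k => N.Sole n (N.winSlot n ω) k ω) ⟨k, hs ▸ h⟩
  rw [hs] at this
  exact Sole.unique this h

theorem measurable_winSlot (n : ℕ) : Measurable[N.block (Idx.sends n)] (N.winSlot n) :=
  measurable_sInf_nat fun s =>
    N.block_mono (Idx.slot_subset_sends n s) _ (N.measurableSet_success n s)

theorem measurable_w [NeZero K] (n : ℕ) : Measurable[N.block (Idx.sends n)] (N.w n) := by
  -- The choice operator is moved onto the finite set of sending patterns. There every function is
  -- measurable, and `w n` is `W` of the pattern in slot `winSlot n`.
  let W : (Fin K → Bool) → Fin K := fun b =>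
    Classical.epsilon fun k => b k = true ∧ ∀ j, j ≠ k → b j = false
  have hF : ∀ s, Measurable[N.block (Idx.sends n)] fun ω => W fun k => N.send n s k ω := fun s =>
    (Measurable.of_discrete (f := W)).comp
      (@measurable_pi_lambda _ _ _ (N.block (Idx.sends n)) _ _
        fun k => N.measurable_send_block ⟨s, k, rfl⟩)
  exact measurable_eval_countable (mΩ := N.block (Idx.sends n)) (N.measurable_winSlot n)
    (F := fun s ω => W fun k => N.send n s k ω) hF

open Classical in
/-- The duration of an unsuccessful slot. -/
def slotCost (n s : ℕ) (ω : Ω) : ℝ := if N.Idle n s ω then c.δ else c.τR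

theorem t_eq (n : ℕ) (ω : Ω) :
    N.t n ω = (∑ s ∈ Finset.range (N.winSlot n ω), N.slotCost n s ω) + c.τM1 := by
  unfold t slotCost Idle
  congr!

theorem slotCost_nonneg (n s : ℕ) (ω : Ω) : 0 ≤ N.slotCost n s ω := by
  unfold slotCost
  split_ifs
  exacts [c.δ_pos.le, c.τR_pos.le]

theorem τM1_le_t (n : ℕ) (ω : Ω) : c.τM1 ≤ N.t n ω := by
  rw [t_eq]
  have := Finset.sum_nonneg fun s (_ : s ∈ Finset.range (N.winSlot n ω)) => N.slotCost_nonneg n s ω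
  linarith

theorem t_pos (n : ℕ) (ω : Ω) : 0 < N.t n ω := c.τM1_pos.trans_le (N.τM1_le_t n ω)

theorem measurable_slotCost (n s : ℕ) : Measurable[N.block (Idx.sends n)] (N.slotCost n s) := by
  unfold slotCost
  exact Measurable.ite (N.block_mono (Idx.slot_subset_sends n s) _ (N.measurableSet_idle n s))
    measurable_const measurable_const

theorem measurable_t (n : ℕ) : Measurable[N.block (Idx.sends n)] (N.t n) := by
  have : N.t n = fun ω => (∑ s ∈ Finset.range (N.winSlot n ω), N.slotCost n s ω) + c.τM1 :=
    funext fun ω => N.t_eq n ω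
  rw [this]
  have h := measurable_eval_countable (mΩ := N.block (Idx.sends n)) (N.measurable_winSlot n)
    (F := fun j ω => ∑ s ∈ Finset.range j, N.slotCost n s ω)
    (fun j => Finset.measurable_fun_sum _ fun s _ => N.measurable_slotCost n s)
  exact h.add_const _

/-- Sum over the slot in which `k` wins: `∑ (1 - ps)^s * (π_k * ps) = π_k`. An inequality is enough,
and it avoids discussing the default value of `w` when no slot succeeds. -/
theorem winProb_le_real_w [NeZero K] [IsProbabilityMeasure P] (n : ℕ) (k : Fin K) :
    c.winProb k ≤ P.real {ω | N.w n ω = k} := by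
  set E : ℕ → Set Ω := fun s => {ω | N.Pending n s ω} ∩ {ω | N.Sole n s k ω} with hE
  have hmeas : ∀ s, MeasurableSet (E s) := fun s =>
    (N.block_le _ _ (N.measurableSet_pending n s)).inter
      (N.block_le _ _ (N.measurableSet_sole n s k))
  have hdisj : Pairwise (Function.onFun Disjoint E) := by
    intro s s' hne
    refine Set.disjoint_left.2 fun ω h h' => hne ?_
    rw [← (N.winSlot_eq_iff ⟨k, h.2⟩).2 h.1, ← (N.winSlot_eq_iff ⟨k, h'.2⟩).2 h'.1]
  have hreal : ∀ s, P.real (E s) = (1 - c.ps) ^ s * (c.winProb k * c.ps) := fun s => by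
    rw [hE, N.real_pending_inter n s (N.measurableSet_sole n s k), real_pending, real_sole]
  have hsum : HasSum (fun s => P.real (E s)) (c.winProb k) := by
    simp_rw [hreal]
    have h := (hasSum_geometric_of_lt_one N.one_sub_ps_mem.1 N.one_sub_ps_mem.2).mul_right
      (c.winProb k * c.ps)
    have hps : c.ps ≠ 0 := c.ps_pos.ne'
    have heq : (1 - (1 - c.ps))⁻¹ * (c.winProb k * c.ps) = c.winProb k := by
      rw [sub_sub_cancel]; field_simp
    rwa [heq] at h
  have h1 : ∀ S : Finset ℕ, ∑ s ∈ S, P.real (E s) ≤ P.real {ω | N.w n ω = k} := fun S => by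
    rw [← measureReal_biUnion_finset (fun s _ s' _ hne => hdisj hne) fun s _ => hmeas s]
    refine measureReal_mono (Set.iUnion₂_subset fun s _ ω hω => ?_)
    exact N.w_eq hω.2 hω.1
  exact hasSum_le_of_sum_le hsum h1

/-- The law of the winner. -/
theorem real_w [NeZero K] [IsProbabilityMeasure P] (n : ℕ) (k : Fin K) :
    P.real {ω | N.w n ω = k} = c.winProb k := by
  have hsum : ∑ k, P.real {ω | N.w n ω = k} = 1 := by
    rw [← measureReal_iUnion_fintype]
    · have : ⋃ k, {ω | N.w n ω = k} = Set.univ := by ext; simp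
      rw [this]; simp
    · intro i j hij
      exact Set.disjoint_left.2 fun ω hi hj => hij (hi.symm.trans hj)
    · exact fun k => N.block_le _ _ (N.measurable_w n (measurableSet_singleton k))
  -- Both families sum to one, so the termwise inequalities are equalities.
  have h := (Finset.sum_eq_sum_iff_of_le fun k _ => N.winProb_le_real_w n k).1
    (c.sum_winProb.trans hsum.symm)
  exact (h k (Finset.mem_univ k)).symm

/-- The mean duration of a contention. -/
theorem integrable_t_and_integral_t [IsProbabilityMeasure P] (n : ℕ) :
    Integrable (N.t n) P ∧ ∫ ω, N.t n ω ∂P = c.τo := by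
  classical
  have hidle : ∀ s, MeasurableSet {ω | N.Idle n s ω} :=
    fun s => N.block_le _ _ (N.measurableSet_idle n s)
  have hcoll : ∀ s, MeasurableSet[N.block (Idx.slot n s)]
      ({ω | N.Idle n s ω}ᶜ ∩ {ω | N.Success n s ω}ᶜ) := fun s =>
    (N.measurableSet_idle n s).compl.inter (N.measurableSet_success n s).compl
  have hdisj : ∀ s, Disjoint {ω | N.Idle n s ω} {ω | N.Success n s ω} := fun s =>
    Set.disjoint_left.2 fun ω h ⟨k, hk⟩ => by
      have := h k
      simp [hk.1] at this
  -- Mean cost of a slot when a successful slot is counted as free. Slot `s` is reached with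
  -- probability `(1 - ps)^s`, so the failed slots cost `q / ps` in the mean.
  set q : ℝ := (∏ k, (1 - c.p k)) * c.δ + (1 - (∏ k, (1 - c.p k)) - c.ps) * c.τR with hq
  have hrcoll : ∀ s, P.real ({ω | N.Idle n s ω}ᶜ ∩ {ω | N.Success n s ω}ᶜ) =
      1 - (∏ k, (1 - c.p k)) - c.ps := fun s => by
    rw [← Set.compl_union, probReal_compl_eq_one_sub
      ((hidle s).union (N.block_le _ _ (N.measurableSet_success n s))),
      measureReal_union (hdisj s) (N.block_le _ _ (N.measurableSet_success n s)),
      real_idle, real_success]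
    ring
  have hprod0 : 0 ≤ ∏ k, (1 - c.p k) := Finset.prod_nonneg fun k _ => sub_nonneg.2 (c.p_le_one k)
  have hq0 : 0 ≤ q := add_nonneg (mul_nonneg hprod0 c.δ_pos.le)
    (mul_nonneg (hrcoll 0 ▸ measureReal_nonneg) c.τR_pos.le)
  have hgeo := N.one_sub_ps_mem
  have hlin : ∀ s, ∫⁻ ω, (if s < N.winSlot n ω then ENNReal.ofReal (N.slotCost n s ω) else 0) ∂P =
      ENNReal.ofReal ((1 - c.ps) ^ s * q) := by
    intro s
    have hae : (fun ω => if s < N.winSlot n ω then ENNReal.ofReal (N.slotCost n s ω) else 0) =ᵐ[P]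
        fun ω => ({ω | N.Pending n s ω} ∩ {ω | N.Idle n s ω}).indicator
            (fun _ => ENNReal.ofReal c.δ) ω +
          ({ω | N.Pending n s ω} ∩ ({ω | N.Idle n s ω}ᶜ ∩ {ω | N.Success n s ω}ᶜ)).indicator
            (fun _ => ENNReal.ofReal c.τR) ω := by
      filter_upwards [N.ae_exists_success n] with ω hω
      simp only [N.lt_winSlot_iff hω, slotCost, Set.indicator_apply, Set.mem_inter_iff,
        Set.mem_ofPred_eq, Set.mem_compl_iff]
      have hd : N.Idle n s ω → ¬ N.Success n s ω := fun h h' =>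
        Set.disjoint_left.1 (hdisj s) h h'
      by_cases h1 : N.Pending n s ω <;> by_cases h2 : N.Idle n s ω <;>
        by_cases h3 : N.Success n s ω <;> simp_all
    have hmp := N.block_le _ _ (N.measurableSet_pending n s)
    rw [lintegral_congr_ae hae, lintegral_add_left
      (measurable_const.indicator (hmp.inter (hidle s))),
      lintegral_indicator_const (hmp.inter (hidle s)),
      lintegral_indicator_const (hmp.inter (N.block_le _ _ (hcoll s))),
      ← ofReal_measureReal, ← ofReal_measureReal,
      N.real_pending_inter n s (N.measurableSet_idle n s), N.real_pending_inter n s (hcoll s),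
      hrcoll, real_idle, real_pending, ← ENNReal.ofReal_mul c.δ_pos.le,
      ← ENNReal.ofReal_mul c.τR_pos.le, ← ENNReal.ofReal_add]
    · congr 1; rw [hq]; ring
    · exact mul_nonneg c.δ_pos.le (mul_nonneg (pow_nonneg hgeo.1 _) hprod0)
    · exact mul_nonneg c.τR_pos.le
        (mul_nonneg (pow_nonneg hgeo.1 _) (hrcoll 0 ▸ measureReal_nonneg))
  have hmt : ∀ s, Measurable fun ω =>
      (if s < N.winSlot n ω then ENNReal.ofReal (N.slotCost n s ω) else 0) := fun s =>
    Measurable.ite (((N.measurable_winSlot n).mono (N.block_le _) le_rfl) measurableSet_Ioi)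
      ((N.measurable_slotCost n s).mono (N.block_le _) le_rfl).ennreal_ofReal measurable_const
  have hX : Integrable (fun ω => N.t n ω - c.τM1) P ∧ ∫ ω, (N.t n ω - c.τM1) ∂P = q / c.ps := by
    refine integrable_and_integral_eq
      (((N.measurable_t n).mono (N.block_le _) le_rfl).sub_const _)
      (fun ω => sub_nonneg.2 (N.τM1_le_t n ω)) (div_nonneg hq0 c.ps_pos.le) ?_
    have hsum : ∀ ω, ENNReal.ofReal (N.t n ω - c.τM1) =
        ∑' s, if s < N.winSlot n ω then ENNReal.ofReal (N.slotCost n s ω) else 0 := by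
      intro ω
      rw [t_eq, add_sub_cancel_right, ENNReal.ofReal_sum_of_nonneg
        fun s _ => N.slotCost_nonneg n s ω, tsum_eq_sum (s := Finset.range (N.winSlot n ω))]
      · exact Finset.sum_congr rfl fun s hs => by rw [if_pos (Finset.mem_range.1 hs)]
      · intro s hs
        rw [if_neg (by simpa using hs)]
    simp_rw [hsum]
    rw [lintegral_tsum fun s => (hmt s).aemeasurable]
    simp_rw [hlin]
    have hS := (hasSum_geometric_of_lt_one hgeo.1 hgeo.2).mul_right q
    rw [← ENNReal.ofReal_tsum_of_nonneg (fun s => mul_nonneg (pow_nonneg hgeo.1 _) hq0)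
      hS.summable, hS.tsum_eq, sub_sub_cancel, inv_mul_eq_div]
  have ht : N.t n = fun ω => (N.t n ω - c.τM1) + c.τM1 := by ext; ring
  constructor
  · rw [ht]; exact hX.1.add (integrable_const _)
  · rw [ht, integral_add hX.1 (integrable_const _), hX.2]
    simp only [integral_const, probReal_univ, one_smul, Params.τo, hq]
    ring

theorem τo_pos [IsProbabilityMeasure P] (N : Network c P) : 0 < c.τo := by
  have h := N.integrable_t_and_integral_t 0
  rw [← h.2]
  refine c.τM1_pos.trans_le ?_
  have := integral_mono (integrable_const c.τM1) h.1 (N.τM1_le_t 0)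
  simpa using this

end Network

/-! ### Integrating out an independent variable. -/

section Freezing

variable {Ω E F : Type*} {m₁ m₂ : MeasurableSpace Ω} {mΩ : MeasurableSpace Ω} {P : Measure Ω}
  [MeasurableSpace E] [MeasurableSpace F]

/-- Since `B` and `X` live in `m₁`, restricting to `B` does not disturb independence from `Z`.
Keeping the event `B` takes the place of a conditional expectation. -/
theorem map_prodMk_restrict_of_indep [IsFiniteMeasure P] (h₁ : m₁ ≤ mΩ) (h₂ : m₂ ≤ mΩ)
    (hind : Indep m₁ m₂ P) {X : Ω → E} {Z : Ω → F} (hX : Measurable[m₁] X) (hZ : Measurable[m₂] Z)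
    {B : Set Ω} (hB : MeasurableSet[m₁] B) :
    (P.restrict B).map (fun ω => (X ω, Z ω)) = ((P.restrict B).map X).prod (P.map Z) := by
  have hX' : Measurable X := hX.mono h₁ le_rfl
  have hZ' : Measurable Z := hZ.mono h₂ le_rfl
  refine (Measure.prod_eq fun s t hs ht => ?_).symm
  rw [Measure.map_apply (hX'.prodMk hZ') (hs.prod ht), Measure.map_apply hX' hs,
    Measure.map_apply hZ' ht, Measure.restrict_apply (hX' hs),
    Measure.restrict_apply ((hX'.prodMk hZ') (hs.prod ht)),
    ← (Indep_iff _ _ _).1 hind _ _ ((hX hs).inter hB) (hZ ht)]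
  congr 1
  ext ω
  simp only [Set.mem_inter_iff, Set.mem_preimage, Set.mem_prod]
  tauto

theorem map_prodMk_of_indep [IsFiniteMeasure P] (h₁ : m₁ ≤ mΩ) (h₂ : m₂ ≤ mΩ)
    (hind : Indep m₁ m₂ P) {X : Ω → E} {Z : Ω → F} (hX : Measurable[m₁] X)
    (hZ : Measurable[m₂] Z) :
    P.map (fun ω => (X ω, Z ω)) = (P.map X).prod (P.map Z) := by
  have h := map_prodMk_restrict_of_indep h₁ h₂ hind hX hZ (B := Set.univ)
    (@MeasurableSet.univ _ m₁)
  simpa using h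

/-- On an event that is independent of `Z`, the expectation is taken over `Z` first. -/
theorem setIntegral_of_indep [IsFiniteMeasure P] (h₁ : m₁ ≤ mΩ) (h₂ : m₂ ≤ mΩ)
    (hind : Indep m₁ m₂ P) {X : Ω → E} {Z : Ω → F} (hX : Measurable[m₁] X) (hZ : Measurable[m₂] Z)
    {B : Set Ω} (hB : MeasurableSet[m₁] B) {φ : E × F → ℝ} (hφ : Measurable φ)
    (hint : Integrable (fun ω => φ (X ω, Z ω)) P) :
    ∫ ω in B, φ (X ω, Z ω) ∂P = ∫ ω in B, ∫ z, φ (X ω, z) ∂(P.map Z) ∂P := by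
  have hX' : Measurable X := hX.mono h₁ le_rfl
  have hXZ : Measurable fun ω => (X ω, Z ω) := hX'.prodMk (hZ.mono h₂ le_rfl)
  have hmap := map_prodMk_restrict_of_indep h₁ h₂ hind hX hZ hB
  have hint' : Integrable φ (((P.restrict B).map X).prod (P.map Z)) := by
    rw [← hmap, integrable_map_measure hφ.aestronglyMeasurable hXZ.aemeasurable]
    exact hint.restrict
  rw [← integral_map (μ := P.restrict B) hXZ.aemeasurable hφ.aestronglyMeasurable, hmap,
    integral_prod _ hint', integral_map hX'.aemeasurable]
  exact hφ.stronglyMeasurable.integral_prod_right'.aestronglyMeasurable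

theorem setIntegral_eq_mul_of_indep [IsFiniteMeasure P] (h₁ : m₁ ≤ mΩ) (h₂ : m₂ ≤ mΩ)
    (hind : Indep m₁ m₂ P) {Z : Ω → ℝ} (hZ : Measurable[m₂] Z) {B : Set Ω}
    (hB : MeasurableSet[m₁] B) (hint : Integrable Z P) :
    ∫ ω in B, Z ω ∂P = P.real B * ∫ ω, Z ω ∂P := by
  -- With a trivial `X` the inner integral is constant.
  have h := setIntegral_of_indep h₁ h₂ hind (X := fun _ => ()) (Z := Z)
    (@measurable_const _ _ _ m₁ _) hZ hB (φ := fun z => z.2) measurable_snd hint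
  rw [h, setIntegral_const, integral_map (hZ.mono h₂ le_rfl).aemeasurable (by fun_prop)]
  rfl

end Freezing

/-! ### Quantities indexed by the random winner, split according to its value. -/

section Eval

variable {Ω ι : Type*} [mΩ : MeasurableSpace Ω] {P : Measure Ω} [Fintype ι] [MeasurableSpace ι]
  [MeasurableSingletonClass ι]

theorem integrable_eval {i : Ω → ι} {F : ι → Ω → ℝ} (hi : Measurable i)
    (hm : ∀ j, Measurable (F j)) (hF : ∀ j, Integrable (F j) P) :
    Integrable (fun ω => F (i ω) ω) P := by
  refine Integrable.mono' (integrable_finsetSum Finset.univ fun j _ => (hF j).norm)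
    (measurable_eval_countable hi hm).aestronglyMeasurable
    (Filter.Eventually.of_forall fun ω => ?_)
  exact Finset.single_le_sum (f := fun j => ‖F j ω‖) (fun j _ => norm_nonneg _)
    (Finset.mem_univ (i ω))

theorem setIntegral_eval {i : Ω → ι} {F : ι → Ω → ℝ} (hi : Measurable i)
    (hm : ∀ j, Measurable (F j)) (hF : ∀ j, Integrable (F j) P) {B : Set Ω}
    (hB : MeasurableSet B) :
    ∫ ω in B, F (i ω) ω ∂P = ∑ j, ∫ ω in B ∩ {ω | i ω = j}, F j ω ∂P := by
  have hmeas : ∀ j, MeasurableSet (B ∩ {ω | i ω = j}) := fun j =>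
    hB.inter (hi (measurableSet_singleton j))
  have hU : B = ⋃ j, B ∩ {ω | i ω = j} := by ext; simp
  conv_lhs => rw [hU]
  rw [integral_iUnion_fintype hmeas]
  · refine Finset.sum_congr rfl fun j _ => setIntegral_congr_fun (hmeas j) ?_
    rintro ω ⟨-, rfl⟩
    rfl
  · intro j j' hne
    exact Set.disjoint_left.2 fun ω h h' => hne (h.2.symm.trans h'.2)
  · exact fun j => (integrable_eval hi hm hF).integrableOn

end Eval

/-! ### Laws of the channels seen at a contention, and information along a strategy. -/

namespace Network

variable {K M : ℕ} {c : Params K M} {Ω : Type*} [mΩ : MeasurableSpace Ω] {P : Measure Ω}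
variable (N : Network c P)

/-- The coefficients of the two hops of pair `k` through the RIS at contention `n`. -/
def fg (n : ℕ) (k : Fin K) (ω : Ω) : (Fin M → ℂ) × (Fin M → ℂ) :=
  (fun m => N.f n k m ω, fun m => N.g n k m ω)

theorem measurable_hop₁ (n : ℕ) (k : Fin K) :
    Measurable[N.block (Idx.hop₁ n)] (fun ω m => N.f n k m ω) :=
  @measurable_pi_lambda _ _ _ (N.block (Idx.hop₁ n)) _ _ fun m => N.measurable_f_block n k m

theorem measurable_hop₂ (n : ℕ) (k : Fin K) :
    Measurable[N.block (Idx.hop₂ n)] (fun ω m => N.g n k m ω) :=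
  @measurable_pi_lambda _ _ _ (N.block (Idx.hop₂ n)) _ _ fun m => N.measurable_g_block n k m

theorem measurable_fg (n : ℕ) (k : Fin K) : Measurable[N.block (Idx.ris n)] (N.fg n k) :=
  ((N.measurable_hop₁ n k).mono (N.block_mono Set.subset_union_left) le_rfl).prodMk
    ((N.measurable_hop₂ n k).mono (N.block_mono Set.subset_union_right) le_rfl)

theorem measurable_norm_h (n : ℕ) (k : Fin K) :
    Measurable[N.block (Idx.direct n)] (fun ω => ‖N.h n k ω‖) :=
  measurable_norm.comp (N.measurable_h_block n k)

theorem map_norm_h (n : ℕ) (k : Fin K) : P.map (fun ω => ‖N.h n k ω‖) = c.lawAbsH k := by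
  rw [Params.lawAbsH, ← N.law_h n k, Measure.map_map measurable_norm (N.measurable_h n k)]
  rfl

theorem map_hop₁ [IsProbabilityMeasure P] (n : ℕ) (k : Fin K) :
    P.map (fun ω m => N.f n k m ω) = Measure.pi fun _ : Fin M => c.lawF k := by
  have hinj : Function.Injective
      (fun m : Fin M => (.inr (.inr (.inl (n, k, m))) : Idx K M)) := by
    intro i j h; simpa using h
  have h : iIndepFun (N.f n k) P := N.indep.precomp hinj
  rw [h.map_fun_eq_pi_map fun m => (N.measurable_f n k m).aemeasurable]
  simp only [N.law_f]

theorem map_hop₂ [IsProbabilityMeasure P] (n : ℕ) (k : Fin K) :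
    P.map (fun ω m => N.g n k m ω) = Measure.pi fun _ : Fin M => c.lawG k := by
  have hinj : Function.Injective
      (fun m : Fin M => (.inr (.inr (.inr (n, k, m))) : Idx K M)) := by
    intro i j h; simpa using h
  have h : iIndepFun (N.g n k) P := N.indep.precomp hinj
  rw [h.map_fun_eq_pi_map fun m => (N.measurable_g n k m).aemeasurable]
  simp only [N.law_g]

theorem map_fg [IsProbabilityMeasure P] (n : ℕ) (k : Fin K) : P.map (N.fg n k) = c.lawFG k := by
  have h := map_prodMk_of_indep (N.block_le _) (N.block_le _)
    (N.indep_block (Idx.disjoint_hop₁_hop₂ n)) (N.measurable_hop₁ n k) (N.measurable_hop₂ n k)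
  rw [map_hop₁, map_hop₂] at h
  exact h

theorem map_norm_h_fg [IsProbabilityMeasure P] (n : ℕ) (k : Fin K) :
    P.map (fun ω => (‖N.h n k ω‖, N.fg n k ω)) = (c.lawAbsH k).prod (c.lawFG k) := by
  rw [map_prodMk_of_indep (N.block_le _) (N.block_le _)
    (N.indep_block (Idx.disjoint_direct_ris n)) (N.measurable_norm_h n k) (N.measurable_fg n k),
    map_norm_h, map_fg]

theorem measurable_norm_h_fg (n : ℕ) (k : Fin K) :
    Measurable[N.block (Idx.direct n ∪ Idx.ris n)] (fun ω => (‖N.h n k ω‖, N.fg n k ω)) :=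
  ((N.measurable_norm_h n k).mono (N.block_mono Set.subset_union_left) le_rfl).prodMk
    ((N.measurable_fg n k).mono (N.block_mono Set.subset_union_right) le_rfl)

/-- What is observed of the channels at a contention is independent of the earlier contentions,
and its law does not depend on the contention. -/
theorem setIntegral_contention [NeZero K] [IsProbabilityMeasure P] (n : ℕ) {A : Set Ω}
    (hA : MeasurableSet[N.block (Idx.past n)] A)
    {φ : Fin K → ℝ × ((Fin M → ℂ) × (Fin M → ℂ)) → ℝ} (hφ : ∀ k, Measurable (φ k))
    (hint : ∀ k, Integrable (φ k) ((c.lawAbsH k).prod (c.lawFG k))) :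
    Integrable (fun ω => φ (N.w n ω) (‖N.hw n ω‖, N.fg n (N.w n ω) ω)) P ∧
    ∫ ω in A, φ (N.w n ω) (‖N.hw n ω‖, N.fg n (N.w n ω) ω) ∂P =
      P.real A * ∑ k, c.winProb k * ∫ z, φ k z ∂((c.lawAbsH k).prod (c.lawFG k)) := by
  have hw : Measurable (N.w n) := (N.measurable_w n).mono (N.block_le _) le_rfl
  have hZ : ∀ k, Measurable (fun ω => (‖N.h n k ω‖, N.fg n k ω)) := fun k =>
    (N.measurable_norm_h_fg n k).mono (N.block_le _) le_rfl
  have hm : ∀ k, Measurable fun ω => φ k (‖N.h n k ω‖, N.fg n k ω) := fun k => (hφ k).comp (hZ k)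
  have hi : ∀ k, Integrable (fun ω => φ k (‖N.h n k ω‖, N.fg n k ω)) P := fun k => by
    have h := hint k
    rw [← N.map_norm_h_fg n k,
      integrable_map_measure (hφ k).aestronglyMeasurable (hZ k).aemeasurable] at h
    exact h
  refine ⟨integrable_eval (F := fun k ω => φ k (‖N.h n k ω‖, N.fg n k ω)) hw hm hi, ?_⟩
  refine (setIntegral_eval (F := fun k ω => φ k (‖N.h n k ω‖, N.fg n k ω)) hw hm hi
    (N.block_le _ _ hA)).trans ?_
  rw [Finset.mul_sum]
  refine Finset.sum_congr rfl fun k _ => ?_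
  have hwk : MeasurableSet[N.block (Idx.sends n)] {ω | N.w n ω = k} :=
    N.measurable_w n (measurableSet_singleton k)
  -- The event `A` and the winner come from the past and the RTS decisions, the channels of pair `k`
  -- from a disjoint block. `A` is then separated from the winner in the same way.
  rw [setIntegral_eq_mul_of_indep (N.block_le _) (N.block_le _)
    (N.indep_block (Idx.disjoint_past_sends_direct_ris n)) (Z := fun ω =>
      φ k (‖N.h n k ω‖, N.fg n k ω)) ((hφ k).comp (N.measurable_norm_h_fg n k))
    (MeasurableSet.inter (N.block_mono Set.subset_union_left _ hA)
      (N.block_mono Set.subset_union_right _ hwk)) (hi k),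
    ← N.map_norm_h_fg n k, integral_map (hZ k).aemeasurable (hφ k).aestronglyMeasurable]
  simp only [measureReal_def]
  rw [(Indep_iff _ _ _).1 (N.indep_block (Idx.disjoint_past Idx.time_sends)) _ _ hA hwk,
    ENNReal.toReal_mul, ← measureReal_def, ← measureReal_def, real_w, mul_assoc]

theorem setIntegral_t [NeZero K] [IsProbabilityMeasure P] (n : ℕ) {A : Set Ω}
    (hA : MeasurableSet[N.block (Idx.past n)] A) :
    ∫ ω in A, N.t n ω ∂P = P.real A * c.τo := by
  rw [setIntegral_eq_mul_of_indep (N.block_le _) (N.block_le _)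
    (N.indep_block (Idx.disjoint_past Idx.time_sends)) (N.measurable_t n) hA
    (N.integrable_t_and_integral_t n).1, (N.integrable_t_and_integral_t n).2]

attribute [local irreducible] Params.probed in
/-- Mean value of probing the RIS, given what is known before the probing. -/
theorem setIntegral_probed [NeZero K] [IsProbabilityMeasure P] (n : ℕ) (lam : ℝ) {B : Set Ω}
    (hB : MeasurableSet[N.block (Idx.first n)] B) :
    ∫ ω in B, c.probed lam ‖N.hw n ω‖ (N.qw n ω) ∂P =
      ∫ ω in B, c.Λ (N.w n ω) lam ‖N.hw n ω‖ ∂P := by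
  have hw : Measurable (N.w n) := (N.measurable_w n).mono (N.block_le _) le_rfl
  have hh : ∀ k, Measurable (fun ω => ‖N.h n k ω‖) := fun k =>
    (N.measurable_norm_h n k).mono (N.block_le _) le_rfl
  have hZ : ∀ k, Measurable (fun ω => (‖N.h n k ω‖, N.fg n k ω)) := fun k =>
    (N.measurable_norm_h_fg n k).mono (N.block_le _) le_rfl
  have hi : ∀ k, Integrable
      (fun ω => c.probed lam ‖N.h n k ω‖ (Params.cascade (N.fg n k ω))) P := fun k => by
    have h := c.integrable_probed_prod k lam
    rw [← N.map_norm_h_fg n k, integrable_map_measure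
      (c.measurable_probed_cascade lam).aestronglyMeasurable (hZ k).aemeasurable] at h
    exact h
  have hΛ : ∀ k, Integrable (fun ω => c.Λ k lam ‖N.h n k ω‖) P := fun k => by
    have h := c.integrable_Λ k lam
    rw [← N.map_norm_h n k, integrable_map_measure
      (c.measurable_Λ k lam).aestronglyMeasurable (hh k).aemeasurable] at h
    exact h
  have hsplit := setIntegral_eval (F := fun k ω => c.probed lam ‖N.h n k ω‖
    (Params.cascade (N.fg n k ω))) hw (fun k => (c.measurable_probed_cascade lam).comp (hZ k)) hi
    (N.block_le _ _ hB)
  have hsplitΛ := setIntegral_eval (F := fun k ω => c.Λ k lam ‖N.h n k ω‖) hw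
    (fun k => (c.measurable_Λ k lam).comp (hh k)) hΛ (N.block_le _ _ hB)
  have hdir : N.block (Idx.direct n) ≤ N.block (Idx.first n) :=
    N.block_mono (Set.subset_union_right.trans Set.subset_union_right)
  have hsend : N.block (Idx.sends n) ≤ N.block (Idx.first n) :=
    N.block_mono (Set.subset_union_left.trans Set.subset_union_right)
  -- On the event that `k` wins, `‖h_k‖` is known before probing and can be frozen; the RIS
  -- coefficients are independent of that knowledge.
  have hk : ∀ k, ∫ ω in B ∩ {ω | N.w n ω = k},
      c.probed lam ‖N.h n k ω‖ (Params.cascade (N.fg n k ω)) ∂P =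
      ∫ ω in B ∩ {ω | N.w n ω = k}, c.Λ k lam ‖N.h n k ω‖ ∂P := fun k => by
    have h := setIntegral_of_indep (N.block_le _) (N.block_le _)
      (N.indep_block (Idx.disjoint_first_ris n)) ((N.measurable_norm_h n k).mono hdir le_rfl)
      (N.measurable_fg n k) (MeasurableSet.inter hB (hsend _ (N.measurable_w n
        (measurableSet_singleton k)))) (c.measurable_probed_cascade lam) (hi k)
    simp only [N.map_fg, ← c.Λ_eq] at h
    exact h
  simp only [hk] at hsplit
  exact hsplit.trans hsplitΛ.symm

/-! ### Observations along a strategy -/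

section Info

variable [NeZero K] {N} {S : Strategy Ω}

theorem measurable_obs (n : ℕ) : Measurable[N.block (Idx.first n)] (N.obs n) := by
  have hsend : N.block (Idx.sends n) ≤ N.block (Idx.first n) :=
    N.block_mono (Set.subset_union_left.trans Set.subset_union_right)
  have hdir : N.block (Idx.direct n) ≤ N.block (Idx.first n) :=
    N.block_mono (Set.subset_union_right.trans Set.subset_union_right)
  have hw := (N.measurable_w n).mono hsend le_rfl
  refine hw.prodMk (((N.measurable_t n).mono hsend le_rfl).prodMk ?_)
  exact measurable_eval_countable (mΩ := N.block (Idx.first n)) hw (F := fun k => N.h n k)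
    fun k => (N.measurable_h_block n k).mono hdir le_rfl

theorem measurable_qw (n : ℕ) : Measurable[N.block (Idx.past (n + 1))] (N.qw n) := by
  have hw := (N.measurable_w n).mono (N.block_mono (Idx.sends_subset_past n)) le_rfl
  exact measurable_eval_countable (mΩ := N.block (Idx.past (n + 1))) hw
    (F := fun k ω => Params.cascade (N.fg n k ω)) fun k => Params.measurable_cascade.comp
      ((N.measurable_fg n k).mono (N.block_mono (Idx.ris_subset_past n)) le_rfl)

theorem measurable_seen {n : ℕ} (h : Measurable[N.block (Idx.past (n + 1))] (S.first n)) :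
    Measurable[N.block (Idx.past (n + 1))] (N.seen S n) := by
  unfold seen
  refine Measurable.ite ?_ (measurable_qw n) measurable_const
  exact h (MeasurableSpace.measurableSet_top (s := {Action.assist}))

/-- The information depends on the strategy, because `seen` reveals coefficients only where the
strategy probed. Strong induction breaks the circle: earlier decisions are measurable with respect
to earlier information. -/
theorem info₁_le (hS : N.Admissible S) (n : ℕ) : N.info₁ S n ≤ N.block (Idx.first n) := by
  induction n using Nat.strong_induction_on with
  | _ n ih =>
    refine sup_le (iSup₂_le fun l hl => ?_) (iSup₂_le fun l hl => ?_)
    · refine (@Measurable.comap_le _ _ (N.block (Idx.first l)) _ _ (measurable_obs l)).trans ?_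
      rcases hl.lt_or_eq with h | rfl
      · exact N.block_mono ((Idx.first_subset_past l).trans
          ((Idx.past_mono h).trans Set.subset_union_left))
      · exact le_rfl
    · have h1 : Measurable[N.block (Idx.past (l + 1))] (S.first l) :=
        (hS l).1.mono ((ih l hl).trans (N.block_mono (Idx.first_subset_past l))) le_rfl
      exact (@Measurable.comap_le _ _ (N.block (Idx.past (l + 1))) _ _ (measurable_seen h1)).trans
        (N.block_mono ((Idx.past_mono hl).trans Set.subset_union_left))

theorem measurable_first (hS : N.Admissible S) (n : ℕ) :
    Measurable[N.block (Idx.first n)] (S.first n) :=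
  (hS n).1.mono (info₁_le hS n) le_rfl

theorem info₂_le (hS : N.Admissible S) (n : ℕ) : N.info₂ S n ≤ N.block (Idx.past (n + 1)) :=
  sup_le ((info₁_le hS n).trans (N.block_mono (Idx.first_subset_past n)))
    (@Measurable.comap_le _ _ (N.block (Idx.past (n + 1))) _ _ (measurable_seen
      ((measurable_first hS n).mono (N.block_mono (Idx.first_subset_past n)) le_rfl)))

theorem measurable_second (hS : N.Admissible S) (n : ℕ) :
    Measurable[N.block (Idx.past (n + 1))] (S.second n) :=
  (hS n).2.mono (info₂_le hS n) le_rfl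

theorem measurableSet_first (hS : N.Admissible S) (n : ℕ) (a : Action) :
    MeasurableSet[N.block (Idx.first n)] {ω | S.first n ω = a} :=
  measurable_first hS n (MeasurableSpace.measurableSet_top (s := {a}))

theorem measurableSet_stopsAt (hS : N.Admissible S) (n : ℕ) :
    MeasurableSet[N.block (Idx.past (n + 1))] {ω | S.StopsAt n ω} := by
  have h1 := fun a => N.block_mono (Idx.first_subset_past n) _ (measurableSet_first hS n a)
  exact MeasurableSet.union (h1 _)
    (MeasurableSet.inter (h1 _) (measurable_second hS n (measurableSet_singleton true)))

end Info

end Network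

/-! ### Reward and time split over the contentions. -/

/-- The strategy has not stopped before contention `n`. -/
def Strategy.Running {Ω : Type*} (S : Strategy Ω) (n : ℕ) (ω : Ω) : Prop :=
  ∀ l < n, ¬ S.StopsAt l ω

namespace Network

variable {K M : ℕ} {c : Params K M} {Ω : Type*} [mΩ : MeasurableSpace Ω] {P : Measure Ω}
  [NeZero K] {N : Network c P} {S : Strategy Ω}

/-- Whether contention `n` takes place is decided by the past alone, so it is an admissible event
for the estimates per contention. -/
theorem measurableSet_running (hS : N.Admissible S) (n : ℕ) :
    MeasurableSet[N.block (Idx.past n)] {ω | S.Running n ω} := by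
  have : {ω | S.Running n ω} = ⋂ l, ⋂ _ : l < n, {ω | S.StopsAt l ω}ᶜ := by
    ext; simp [Strategy.Running]
  rw [this]
  exact MeasurableSet.iInter fun l => MeasurableSet.iInter fun hl => MeasurableSet.compl
    (N.block_mono (Idx.past_mono hl) _ (measurableSet_stopsAt hS l))

theorem measurable_norm_hw (n : ℕ) : Measurable fun ω => ‖N.hw n ω‖ :=
  (measurable_snd.comp (measurable_snd.comp
    ((measurable_obs n).mono (N.block_le _) le_rfl))).norm

end Network

section Accumulation

variable {Ω : Type*} {S : Strategy Ω}

theorem Strategy.running_iff {ω : Ω} (h : ∃ n, S.StopsAt n ω) (n : ℕ) :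
    S.Running n ω ↔ n ≤ S.stopIdx ω := by
  constructor
  · intro hr
    by_contra hlt
    exact hr _ (not_le.1 hlt) (Nat.sInf_mem (s := {n | S.StopsAt n ω}) h)
  · intro hle l hl
    exact Nat.notMem_of_lt_sInf (s := {n | S.StopsAt n ω}) (hl.trans_le hle)

theorem Strategy.stopsAt_stopIdx {ω : Ω} (h : ∃ n, S.StopsAt n ω) : S.StopsAt (S.stopIdx ω) ω :=
  Nat.sInf_mem (s := {n | S.StopsAt n ω}) h

theorem Strategy.running_succ_iff (n : ℕ) (ω : Ω) :
    S.Running (n + 1) ω ↔ S.Running n ω ∧ ¬ S.StopsAt n ω := by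
  simp only [Strategy.Running, Nat.lt_succ_iff_lt_or_eq]
  grind

end Accumulation

namespace Network

section Cost

variable {K M : ℕ} {c : Params K M} {Ω : Type*} (S : Strategy Ω)

open Classical in
/-- Time spent on contention `n` beyond the contention itself. -/
def stepCost (n : ℕ) (ω : Ω) : ℝ :=
  if S.StopsAt n ω then c.τd - c.τM1 else if S.first n ω = Action.assist then c.τC + c.τp else 0

theorem stepCost_nonneg (n : ℕ) (ω : Ω) : 0 ≤ stepCost (c := c) S n ω := by
  unfold stepCost
  have := c.τM1_lt_τd; have := c.τC_pos; have := c.τp_pos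
  split_ifs <;> linarith

/-- Probing without stopping costs `τM2 - τM1`, which is at most `τd - τM1`. -/
theorem stepCost_le (n : ℕ) (ω : Ω) : stepCost (c := c) S n ω ≤ c.τd - c.τM1 := by
  unfold stepCost
  have := c.τM1_lt_τd; have := c.τM2_le_τd; have := c.τM2_eq
  split_ifs <;> linarith

end Cost

section Time

variable {K M : ℕ} {c : Params K M} {Ω : Type*} [mΩ : MeasurableSpace Ω] {P : Measure Ω}
  (N : Network c P) (S : Strategy Ω)

/-- Time spent on contention `n` by a strategy that has not stopped before. -/
def stepT (n : ℕ) (ω : Ω) : ℝ := N.t n ω + stepCost (c := c) S n ω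

theorem stepT_nonneg (n : ℕ) (ω : Ω) : 0 ≤ N.stepT S n ω :=
  add_nonneg (N.t_pos n ω).le (stepCost_nonneg S n ω)

variable {N S}

/-- The last contention is charged `τd - τM1` whether or not the RIS was probed: probing before a
transmission uses up coherence time and adds none. -/
theorem T_eq_sum_stepT {ω : Ω} (h : ∃ n, S.StopsAt n ω) :
    N.T S ω = ∑ l ∈ Finset.range (S.stopIdx ω + 1), N.stepT S l ω := by
  have hcost : ∑ l ∈ Finset.range (S.stopIdx ω + 1), stepCost (c := c) S l ω =
      (∑ l ∈ Finset.range (S.stopIdx ω),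
        open Classical in if S.first l ω = Action.assist then c.τC + c.τp else 0) +
      (c.τd - c.τM1) := by
    rw [Finset.sum_range_succ]
    congr 1
    · refine Finset.sum_congr rfl fun l hl => ?_
      have : ¬ S.StopsAt l ω := (Strategy.running_iff h (l + 1)).2 (Finset.mem_range.1 hl) l
        (Nat.lt_succ_self l)
      rw [stepCost, if_neg this]
    · rw [stepCost, if_pos (Strategy.stopsAt_stopIdx h)]
  simp only [stepT, Finset.sum_add_distrib, hcost, T, add_assoc]

/-- The indicator replaces the random number of terms, so that expectation and sum can be exchanged
without integrability. -/
theorem ofReal_T {ω : Ω} (h : ∃ n, S.StopsAt n ω) :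
    ENNReal.ofReal (N.T S ω) =
      ∑' n, {ω | S.Running n ω}.indicator (fun ω => ENNReal.ofReal (N.stepT S n ω)) ω := by
  rw [T_eq_sum_stepT h, ENNReal.ofReal_sum_of_nonneg fun n _ => N.stepT_nonneg S n ω,
    tsum_eq_sum (s := Finset.range (S.stopIdx ω + 1))]
  · refine Finset.sum_congr rfl fun n hn => ?_
    rw [Set.indicator_of_mem (show ω ∈ {ω | S.Running n ω} from
      (Strategy.running_iff h n).2 (Nat.lt_succ_iff.1 (Finset.mem_range.1 hn)))]
  · intro n hn
    refine Set.indicator_of_notMem (fun hr => hn ?_) _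
    exact Finset.mem_range.2 (Nat.lt_succ_iff.2 ((Strategy.running_iff h n).1 hr))

theorem τM1_le_T (ω : Ω) : c.τM1 ≤ N.T S ω := by
  have h1 : N.t 0 ω ≤ ∑ l ∈ Finset.range (S.stopIdx ω + 1), N.t l ω :=
    Finset.single_le_sum (f := fun l => N.t l ω) (fun l _ => (N.t_pos l ω).le) (by simp)
  have h2 : 0 ≤ ∑ l ∈ Finset.range (S.stopIdx ω),
      open Classical in if S.first l ω = Action.assist then c.τC + c.τp else 0 := by
    have := c.τC_pos; have := c.τp_pos
    exact Finset.sum_nonneg fun l _ => by split_ifs <;> linarith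
  have := N.τM1_le_t 0 ω
  have := c.τM1_lt_τd
  unfold T
  linarith

theorem integral_T_pos [IsProbabilityMeasure P] (hT : Integrable (N.T S) P) :
    0 < ∫ ω, N.T S ω ∂P := by
  refine c.τM1_pos.trans_le ?_
  have := integral_mono (integrable_const c.τM1) hT fun ω => τM1_le_T ω
  simpa using this

end Time

variable {K M : ℕ} {c : Params K M} {Ω : Type*} [mΩ : MeasurableSpace Ω] {P : Measure Ω}
  [NeZero K] (N : Network c P) (S : Strategy Ω)

attribute [local irreducible] Params.rateD Params.rateR Params.probed

open Classical in
/-- Data transmitted at contention `n` by a strategy that has not stopped before. -/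
def stepY (n : ℕ) (ω : Ω) : ℝ :=
  if S.StopsAt n ω then
    if S.first n ω = Action.halt then (c.τd - c.τM1) * c.rateD ‖N.hw n ω‖
    else (c.τd - c.τM2) * c.rateR ‖N.hw n ω‖ (N.qw n ω)
  else 0

theorem stepY_nonneg (n : ℕ) (ω : Ω) : 0 ≤ N.stepY S n ω := by
  unfold stepY
  split_ifs
  · exact mul_nonneg (sub_nonneg.2 c.τM1_lt_τd.le) (c.rateD_nonneg _)
  · exact mul_nonneg (sub_nonneg.2 c.τM2_le_τd) (c.rateR_nonneg _ _)
  · exact le_rfl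

variable {N S}

theorem Y_eq_stepY {ω : Ω} (h : ∃ n, S.StopsAt n ω) : N.Y S ω = N.stepY S (S.stopIdx ω) ω := by
  rw [stepY, if_pos (Strategy.stopsAt_stopIdx h), Y]

-- Only the stopping index contributes: before it nothing is transmitted, after it the strategy is
-- no longer running.
open Classical in
theorem ofReal_Y {ω : Ω} (h : ∃ n, S.StopsAt n ω) :
    ENNReal.ofReal (N.Y S ω) =
      ∑' n, {ω | S.Running n ω}.indicator (fun ω => ENNReal.ofReal (N.stepY S n ω)) ω := by
  rw [Y_eq_stepY h, tsum_eq_single (S.stopIdx ω)]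
  · exact (Set.indicator_of_mem (s := {ω' | S.Running (S.stopIdx ω) ω'})
      (f := fun ω' => ENNReal.ofReal (N.stepY S (S.stopIdx ω) ω'))
      ((Strategy.running_iff h _).2 le_rfl)).symm
  · intro n hn
    by_cases hr : S.Running n ω
    · have hlt : n < S.stopIdx ω := lt_of_le_of_ne ((Strategy.running_iff h n).1 hr) hn
      have : ¬ S.StopsAt n ω := (Strategy.running_iff h (n + 1)).2 hlt n (Nat.lt_succ_self n)
      rw [Set.indicator_of_mem (show ω ∈ {ω | S.Running n ω} from hr), stepY, if_neg this,
        ENNReal.ofReal_zero]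
    · exact Set.indicator_of_notMem hr _

theorem Y_nonneg (ω : Ω) : 0 ≤ N.Y S ω := by
  unfold Y
  split_ifs
  · exact mul_nonneg (sub_nonneg.2 c.τM1_lt_τd.le) (c.rateD_nonneg _)
  · exact mul_nonneg (sub_nonneg.2 c.τM2_le_τd) (c.rateR_nonneg _ _)

theorem measurable_stopIdx (hS : N.Admissible S) : Measurable S.stopIdx :=
  measurable_sInf_nat fun n => N.block_le _ _ (measurableSet_stopsAt hS n)

theorem measurable_rateD_hw (n : ℕ) : Measurable fun ω => c.rateD ‖N.hw n ω‖ :=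
  c.measurable_rateD.comp (measurable_norm_hw n)

theorem measurable_rateR_hw (n : ℕ) : Measurable fun ω => c.rateR ‖N.hw n ω‖ (N.qw n ω) :=
  c.measurable_rateR.comp
    ((measurable_norm_hw n).prodMk ((measurable_qw n).mono (N.block_le _) le_rfl))

theorem measurable_Y (hS : N.Admissible S) : Measurable (N.Y S) := by
  classical
  exact measurable_eval_countable (measurable_stopIdx hS) (F := fun n ω =>
    if S.first n ω = Action.halt then (c.τd - c.τM1) * c.rateD ‖N.hw n ω‖
    else (c.τd - c.τM2) * c.rateR ‖N.hw n ω‖ (N.qw n ω)) fun n =>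
      Measurable.ite (N.block_le _ _ (measurableSet_first hS n _))
        ((measurable_rateD_hw n).const_mul _) ((measurable_rateR_hw n).const_mul _)

theorem measurable_T (hS : N.Admissible S) : Measurable (N.T S) := by
  classical
  have ht : ∀ n, Measurable (N.t n) := fun n => (N.measurable_t n).mono (N.block_le _) le_rfl
  exact measurable_eval_countable (measurable_stopIdx hS) (F := fun n ω =>
    (∑ l ∈ Finset.range (n + 1), N.t l ω) + (∑ l ∈ Finset.range n,
      if S.first l ω = Action.assist then c.τC + c.τp else 0) + (c.τd - c.τM1)) fun n =>
      (((Finset.measurable_fun_sum _ fun l _ => ht l).add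
        (Finset.measurable_fun_sum _ fun l _ => Measurable.ite
          (N.block_le _ _ (measurableSet_first hS l _)) measurable_const
          measurable_const)).add_const _)

theorem measurable_stepY (hS : N.Admissible S) (n : ℕ) : Measurable (N.stepY S n) :=
  Measurable.ite (N.block_le _ _ (measurableSet_stopsAt hS n))
    (Measurable.ite (N.block_le _ _ (measurableSet_first hS n _))
      ((measurable_rateD_hw n).const_mul _) ((measurable_rateR_hw n).const_mul _)) measurable_const

theorem measurable_stepCost (hS : N.Admissible S) (n : ℕ) : Measurable (stepCost (c := c) S n) :=
  Measurable.ite (N.block_le _ _ (measurableSet_stopsAt hS n)) measurable_const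
    (Measurable.ite (N.block_le _ _ (measurableSet_first hS n _)) measurable_const measurable_const)

/-! ### The net reward of one contention -/

open Classical in
/-- Net reward at price `lam` after the first observation, with the best second decision. -/
def afterFirst (N : Network c P) (S : Strategy Ω) (lam : ℝ) (n : ℕ) (ω : Ω) : ℝ :=
  if S.first n ω = Action.halt then c.direct lam ‖N.hw n ω‖
  else {ω | S.first n ω = Action.assist}.indicator
    (fun ω => c.probed lam ‖N.hw n ω‖ (N.qw n ω)) ω

open Classical in
/-- Mean net reward at price `lam` before the second observation. -/
def beforeSecond (N : Network c P) (S : Strategy Ω) (lam : ℝ) (n : ℕ) (ω : Ω) : ℝ :=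
  if S.first n ω = Action.halt then c.direct lam ‖N.hw n ω‖
  else {ω | S.first n ω = Action.assist}.indicator
    (fun ω => c.Λ (N.w n ω) lam ‖N.hw n ω‖) ω

/-- After probing, stopping and continuing yield the two branches of the maximum in `probed`; the
second decision is thus bounded pointwise. -/
theorem step_le_afterFirst (lam : ℝ) (n : ℕ) (ω : Ω) :
    N.stepY S n ω - lam * stepCost (c := c) S n ω ≤ N.afterFirst S lam n ω := by
  have h2 := c.τM2_eq
  unfold stepY stepCost afterFirst Params.direct Params.probed
  rcases hf : S.first n ω with _ | _ | _
  · simp only [Strategy.StopsAt, hf, true_or, if_true]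
    linarith
  · simp [Strategy.StopsAt, hf]
  · by_cases hs : S.second n ω = true
    · simp [Strategy.StopsAt, hf, hs]
    · simp only [Strategy.StopsAt, hf, hs, reduceCtorEq, and_false, or_self, if_false, if_true,
        Set.indicator_of_mem (show ω ∈ {ω | S.first n ω = Action.assist} from hf)]
      refine le_trans (le_of_eq ?_) (le_max_right _ _)
      ring

/-- The three actions yield the three terms of the maximum in `gain`, with 0 for continuing. -/
theorem beforeSecond_le_gain (lam : ℝ) (n : ℕ) (ω : Ω) :
    N.beforeSecond S lam n ω ≤ c.gain (N.w n ω) lam ‖N.hw n ω‖ := by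
  unfold beforeSecond Params.gain
  rcases hf : S.first n ω with _ | _ | _
  · simp
  · simp [hf]
  · simp [hf]

theorem lintegral_indicator_running {f : Ω → ℝ} (hS : N.Admissible S) (n : ℕ)
    (hf : Integrable f P) (h0 : ∀ ω, 0 ≤ f ω) :
    ∫⁻ ω, {ω | S.Running n ω}.indicator (fun ω => ENNReal.ofReal (f ω)) ω ∂P =
      ENNReal.ofReal (∫ ω in {ω | S.Running n ω}, f ω ∂P) := by
  rw [lintegral_indicator (N.block_le _ _ (measurableSet_running hS n)),
    ofReal_integral_eq_lintegral_ofReal hf.restrict (Filter.Eventually.of_forall h0)]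

theorem integrable_Y_of_lintegral_le {lam : ℝ} (hF : N.Feasible S)
    (hle : ∫⁻ ω, ENNReal.ofReal (N.Y S ω) ∂P ≤
      ENNReal.ofReal lam * ∫⁻ ω, ENNReal.ofReal (N.T S ω) ∂P) : Integrable (N.Y S) P := by
  have hT0 : ∀ ω, 0 ≤ N.T S ω := fun ω => c.τM1_pos.le.trans (τM1_le_T ω)
  refine (lintegral_ofReal_ne_top_iff_integrable (measurable_Y hF.1).aestronglyMeasurable
    (Filter.Eventually.of_forall Y_nonneg)).1 (ne_top_of_le_ne_top ?_ hle)
  exact ENNReal.mul_ne_top ENNReal.ofReal_ne_top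
    ((lintegral_ofReal_ne_top_iff_integrable hF.2.2.aestronglyMeasurable
      (Filter.Eventually.of_forall hT0)).2 hF.2.2)

variable [IsProbabilityMeasure P]

theorem integrable_stepT (hS : N.Admissible S) (n : ℕ) : Integrable (N.stepT S n) P := by
  refine (N.integrable_t_and_integral_t n).1.add (Integrable.mono' (integrable_const (c.τd - c.τM1))
    (measurable_stepCost hS n).aestronglyMeasurable (Filter.Eventually.of_forall fun ω => ?_))
  rw [Real.norm_of_nonneg (stepCost_nonneg S n ω)]
  exact stepCost_le S n ω

theorem integrable_rateD_hw (n : ℕ) : Integrable (fun ω => c.rateD ‖N.hw n ω‖) P :=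
  (N.setIntegral_contention n (@MeasurableSet.univ _ (N.block _)) (φ := fun _ z => c.rateD z.1)
    (fun _ => c.measurable_rateD.comp measurable_fst) fun k =>
      (c.integrable_rateD measurable_id (c.integrable_abs_lawAbsH k)).comp_fst _).1

theorem integrable_rateR_hw (n : ℕ) : Integrable (fun ω => c.rateR ‖N.hw n ω‖ (N.qw n ω)) P := by
  have hm : Measurable fun z : ℝ × ((Fin M → ℂ) × (Fin M → ℂ)) =>
      c.rateR z.1 (Params.cascade z.2) :=
    c.measurable_rateR.comp (measurable_fst.prodMk (Params.measurable_cascade.comp measurable_snd))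
  exact (N.setIntegral_contention n (@MeasurableSet.univ _ (N.block _))
    (φ := fun _ z => c.rateR z.1 (Params.cascade z.2)) (fun _ => hm) fun k =>
      c.integrable_rateR measurable_fst (Params.measurable_cascade.comp measurable_snd)
        ((c.integrable_abs_lawAbsH k).comp_fst _)
        (fun m => (c.integrable_norm_cascade k m).comp_snd _)).1

theorem integrable_stepY (hS : N.Admissible S) (n : ℕ) : Integrable (N.stepY S n) P := by
  refine Integrable.mono' (((integrable_rateD_hw (N := N) n).const_mul (c.τd - c.τM1)).add
    ((integrable_rateR_hw (N := N) n).const_mul (c.τd - c.τM2)))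
    (measurable_stepY hS n).aestronglyMeasurable (Filter.Eventually.of_forall fun ω => ?_)
  rw [Real.norm_of_nonneg (N.stepY_nonneg S n ω)]
  have h1 := mul_nonneg (sub_nonneg.2 c.τM1_lt_τd.le) (c.rateD_nonneg ‖N.hw n ω‖)
  have h2 := mul_nonneg (sub_nonneg.2 c.τM2_le_τd) (c.rateR_nonneg ‖N.hw n ω‖ (N.qw n ω))
  simp only [Pi.add_apply]
  unfold stepY
  split_ifs <;> linarith

theorem integrable_direct_hw (lam : ℝ) (n : ℕ) :
    Integrable (fun ω => c.direct lam ‖N.hw n ω‖) P :=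
  ((integrable_rateD_hw n).sub (integrable_const lam)).const_mul _

theorem integrable_probed_hw (lam : ℝ) (n : ℕ) :
    Integrable (fun ω => c.probed lam ‖N.hw n ω‖ (N.qw n ω)) P := by
  unfold Params.probed
  exact (((integrable_rateR_hw n).const_mul _).sub (integrable_const _)).sup (integrable_const _)

theorem integrable_Λ_hw (lam : ℝ) (n : ℕ) :
    Integrable (fun ω => c.Λ (N.w n ω) lam ‖N.hw n ω‖) P :=
  (N.setIntegral_contention n (@MeasurableSet.univ _ (N.block _)) (φ := fun k z => c.Λ k lam z.1)
    (fun k => (c.measurable_Λ k lam).comp measurable_fst) fun k =>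
      (c.integrable_Λ k lam).comp_fst _).1

theorem integrable_gain_hw (lam : ℝ) (n : ℕ) :
    Integrable (fun ω => c.gain (N.w n ω) lam ‖N.hw n ω‖) P :=
  ((integrable_direct_hw lam n).sup (integrable_Λ_hw lam n)).sup (integrable_const 0)

theorem setIntegral_gain_hw (lam : ℝ) (n : ℕ) {A : Set Ω}
    (hA : MeasurableSet[N.block (Idx.past n)] A) :
    ∫ ω in A, c.gain (N.w n ω) lam ‖N.hw n ω‖ ∂P = P.real A * c.meanGain lam := by
  have h := (N.setIntegral_contention n hA (φ := fun k z => c.gain k lam z.1)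
    (fun k => (c.measurable_gain k lam).comp measurable_fst) fun k =>
      (c.integrable_gain k lam).comp_fst _).2
  rw [h, Params.meanGain]
  congr 1
  refine Finset.sum_congr rfl fun k _ => ?_
  rw [integral_fun_fst]
  simp

theorem integrable_afterFirst (hS : N.Admissible S) (lam : ℝ) (n : ℕ) :
    Integrable (N.afterFirst S lam n) P := by
  have hm : ∀ a, MeasurableSet {ω | S.first n ω = a} := fun a =>
    N.block_le _ _ (measurableSet_first hS n a)
  classical
  exact Integrable.piecewise (hm Action.halt) (integrable_direct_hw lam n).integrableOn
    ((integrable_probed_hw lam n).indicator (hm Action.assist)).integrableOn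

theorem integrable_beforeSecond (hS : N.Admissible S) (lam : ℝ) (n : ℕ) :
    Integrable (N.beforeSecond S lam n) P := by
  have hm : ∀ a, MeasurableSet {ω | S.first n ω = a} := fun a =>
    N.block_le _ _ (measurableSet_first hS n a)
  classical
  exact Integrable.piecewise (hm Action.halt) (integrable_direct_hw lam n).integrableOn
    ((integrable_Λ_hw lam n).indicator (hm Action.assist)).integrableOn

/-- The choice to probe precedes the sight of the RIS coefficients, so on that event `probed` may be
replaced by its mean `Λ`. -/
theorem setIntegral_afterFirst (hS : N.Admissible S) (lam : ℝ) (n : ℕ) {A : Set Ω}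
    (hA : MeasurableSet[N.block (Idx.past n)] A) :
    ∫ ω in A, N.afterFirst S lam n ω ∂P = ∫ ω in A, N.beforeSecond S lam n ω ∂P := by
  have hm : MeasurableSet {ω | S.first n ω = Action.assist} :=
    N.block_le _ _ (measurableSet_first hS n _)
  have hB : MeasurableSet[N.block (Idx.first n)] (A ∩ {ω | S.first n ω = Action.assist}) :=
    MeasurableSet.inter (N.block_mono Set.subset_union_left _ hA) (measurableSet_first hS n _)
  have hdiff : ∀ ω, N.afterFirst S lam n ω = N.beforeSecond S lam n ω +
      ({ω | S.first n ω = Action.assist}.indicator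
        (fun ω => c.probed lam ‖N.hw n ω‖ (N.qw n ω)) ω -
      {ω | S.first n ω = Action.assist}.indicator
        (fun ω => c.Λ (N.w n ω) lam ‖N.hw n ω‖) ω) := by
    intro ω
    unfold afterFirst beforeSecond
    rcases hf : S.first n ω with _ | _ | _ <;> simp [hf]
  have hp := (integrable_probed_hw (N := N) lam n).indicator hm
  have hΛ := (integrable_Λ_hw (N := N) lam n).indicator hm
  have hsub := hp.sub hΛ
  simp only [Pi.sub_def] at hsub
  simp_rw [hdiff]
  rw [integral_add (integrable_beforeSecond hS lam n).restrict hsub.restrict,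
    integral_sub hp.restrict hΛ.restrict, setIntegral_indicator hm, setIntegral_indicator hm,
    N.setIntegral_probed n lam hB, sub_self, add_zero]

/-- The core estimate. On `A`, the reward minus the price of `stepCost` is bounded in the mean by
`afterFirst`, hence by `beforeSecond`, hence by `gain`, whose integral is `P(A) * meanGain lam`. At
the root this is `lam` times the integral over `A` of the contention time. Equality in both
pointwise bounds gives equality throughout. -/
theorem setIntegral_step_le (hS : N.Admissible S) {lam : ℝ} (hlam : c.meanGain lam = lam * c.τo)
    (n : ℕ) {A : Set Ω} (hA : MeasurableSet[N.block (Idx.past n)] A) :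
    ∫ ω in A, N.stepY S n ω ∂P ≤ lam * ∫ ω in A, N.stepT S n ω ∂P ∧
    ((∀ ω, N.stepY S n ω - lam * stepCost (c := c) S n ω = N.afterFirst S lam n ω) →
      (∀ ω, N.beforeSecond S lam n ω = c.gain (N.w n ω) lam ‖N.hw n ω‖) →
      ∫ ω in A, N.stepY S n ω ∂P = lam * ∫ ω in A, N.stepT S n ω ∂P) := by
  have ht := (N.integrable_t_and_integral_t n).1
  have hY := integrable_stepY hS n
  have hT := integrable_stepT hS n
  have hC : Integrable (stepCost (c := c) S n) P :=
    (hT.sub ht).congr (Filter.Eventually.of_forall fun ω => by simp [stepT])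
  have hsum : ∫ ω in A, N.stepT S n ω ∂P =
      P.real A * c.τo + ∫ ω in A, stepCost (c := c) S n ω ∂P := by
    unfold stepT
    rw [integral_add ht.restrict hC.restrict, N.setIntegral_t n hA]
  have hnet : ∫ ω in A, (N.stepY S n ω - lam * stepCost (c := c) S n ω) ∂P =
      ∫ ω in A, N.stepY S n ω ∂P - lam * ∫ ω in A, stepCost (c := c) S n ω ∂P := by
    rw [integral_sub hY.restrict (hC.const_mul lam).restrict, integral_const_mul]
  have hg := setIntegral_gain_hw (N := N) lam n hA
  rw [hlam] at hg
  have hab := setIntegral_afterFirst hS lam n hA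
  refine ⟨?_, fun h1 h2 => ?_⟩
  · have h1 := setIntegral_mono (hY.sub (hC.const_mul lam)).integrableOn
      (integrable_afterFirst hS lam n).integrableOn (s := A)
      fun ω => step_le_afterFirst (N := N) (S := S) lam n ω
    have h2 := setIntegral_mono (integrable_beforeSecond hS lam n).integrableOn
      (integrable_gain_hw lam n).integrableOn (s := A)
      fun ω => beforeSecond_le_gain (N := N) (S := S) lam n ω
    simp only [Pi.sub_apply] at h1
    rw [hnet] at h1
    rw [hsum]
    linarith
  · simp_rw [h1] at hnet
    simp_rw [h2] at hab
    rw [hsum]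
    linarith

/-! ### Accumulated rewards and costs -/

theorem lintegral_Y (hS : N.Admissible S) (hends : ∀ᵐ ω ∂P, ∃ n, S.StopsAt n ω) :
    ∫⁻ ω, ENNReal.ofReal (N.Y S ω) ∂P =
      ∑' n, ENNReal.ofReal (∫ ω in {ω | S.Running n ω}, N.stepY S n ω ∂P) := by
  rw [lintegral_congr_ae (hends.mono fun ω h => ofReal_Y (N := N) h), lintegral_tsum fun n =>
    ((measurable_stepY hS n).ennreal_ofReal.indicator
      (N.block_le _ _ (measurableSet_running hS n))).aemeasurable]
  exact tsum_congr fun n => lintegral_indicator_running hS n (integrable_stepY hS n)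
    (N.stepY_nonneg S n)

theorem lintegral_T (hS : N.Admissible S) (hends : ∀ᵐ ω ∂P, ∃ n, S.StopsAt n ω) :
    ∫⁻ ω, ENNReal.ofReal (N.T S ω) ∂P =
      ∑' n, ENNReal.ofReal (∫ ω in {ω | S.Running n ω}, N.stepT S n ω ∂P) := by
  have hm : ∀ n, Measurable (N.stepT S n) := fun n =>
    ((N.measurable_t n).mono (N.block_le _) le_rfl).add (measurable_stepCost hS n)
  rw [lintegral_congr_ae (hends.mono fun ω h => ofReal_T (N := N) h), lintegral_tsum fun n =>
    ((hm n).ennreal_ofReal.indicator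
      (N.block_le _ _ (measurableSet_running hS n))).aemeasurable]
  exact tsum_congr fun n => lintegral_indicator_running hS n (integrable_stepT hS n)
    (N.stepT_nonneg S n)

/-- No feasible strategy beats the root of the fixed-point equation. -/
theorem integrable_Y_and_throughput_le {lam : ℝ} (h0 : 0 ≤ lam)
    (hlam : c.meanGain lam = lam * c.τo) (hF : N.Feasible S) :
    Integrable (N.Y S) P ∧ N.throughput S ≤ lam := by
  have hT0 : ∀ ω, 0 ≤ N.T S ω := fun ω => c.τM1_pos.le.trans (τM1_le_T ω)
  -- Comparing in `ENNReal` yields finiteness of E[Y] together with the bound; the difference E[Y] -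
  -- `lam` E[T] would presuppose it.
  have hle : ∫⁻ ω, ENNReal.ofReal (N.Y S ω) ∂P ≤
      ENNReal.ofReal lam * ∫⁻ ω, ENNReal.ofReal (N.T S ω) ∂P := by
    rw [lintegral_Y hF.1 hF.2.1, lintegral_T hF.1 hF.2.1, ← ENNReal.tsum_mul_left]
    refine ENNReal.tsum_le_tsum fun n => ?_
    rw [← ENNReal.ofReal_mul h0]
    exact ENNReal.ofReal_le_ofReal
      (setIntegral_step_le hF.1 hlam n (measurableSet_running hF.1 n)).1
  have hY := integrable_Y_of_lintegral_le hF hle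
  refine ⟨hY, ?_⟩
  rw [throughput, div_le_iff₀ (integral_T_pos hF.2.2)]
  rw [← ofReal_integral_eq_lintegral_ofReal hY (Filter.Eventually.of_forall Y_nonneg),
    ← ofReal_integral_eq_lintegral_ofReal hF.2.2 (Filter.Eventually.of_forall hT0),
    ← ENNReal.ofReal_mul h0] at hle
  exact (ENNReal.ofReal_le_ofReal_iff (mul_nonneg h0 (integral_nonneg hT0))).1 hle

end Network

/-! ### The threshold rule: observability, optimality and feasibility. -/

namespace Network

section Rule

variable {K M : ℕ} {c : Params K M}

attribute [local irreducible] Params.rateD Params.rateR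

open Classical in
/-- First decision of the rule with price `lam`. -/
def ruleFirst (c : Params K M) (lam : ℝ) (k : Fin K) (x : ℝ) : Action :=
  if max (c.Λ k lam x) 0 ≤ c.direct lam x then Action.halt
  else if max (c.direct lam x) (c.Λ k lam x) < 0 then Action.cont
  else Action.assist

theorem measurable_ruleFirst (lam : ℝ) :
    Measurable fun z : Fin K × ℝ × ℂ => ruleFirst c lam z.1 ‖z.2.2‖ := by
  have hx : Measurable fun z : Fin K × ℝ × ℂ => ‖z.2.2‖ :=
    (measurable_snd.comp measurable_snd).norm
  have hD : Measurable fun z : Fin K × ℝ × ℂ => c.direct lam ‖z.2.2‖ :=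
    (c.measurable_direct lam).comp hx
  have hΛ : Measurable fun z : Fin K × ℝ × ℂ => c.Λ z.1 lam ‖z.2.2‖ :=
    measurable_eval_countable measurable_fst
      (F := fun k (z : Fin K × ℝ × ℂ) => c.Λ k lam ‖z.2.2‖)
      fun k => (c.measurable_Λ k lam).comp hx
  exact Measurable.ite (measurableSet_le (hΛ.max measurable_const) hD) measurable_const
    (Measurable.ite (measurableSet_lt (hD.max hΛ) measurable_const) measurable_const
      measurable_const)

/-- Pairs of observations after which the rule stops. -/
def stopRegion (c : Params K M) (lam : ℝ) (k : Fin K) : Set (ℝ × ((Fin M → ℂ) × (Fin M → ℂ))) :=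
  {z | ruleFirst c lam k z.1 = Action.halt ∨
    (ruleFirst c lam k z.1 = Action.assist ∧ lam ≤ c.rateR z.1 (Params.cascade z.2))}

theorem measurableSet_stopRegion (lam : ℝ) (k : Fin K) : MeasurableSet (stopRegion c lam k) := by
  have hf : Measurable fun z : ℝ × ((Fin M → ℂ) × (Fin M → ℂ)) => ruleFirst c lam k z.1 := by
    have hD : Measurable fun z : ℝ × ((Fin M → ℂ) × (Fin M → ℂ)) => c.direct lam z.1 :=
      (c.measurable_direct lam).comp measurable_fst
    have hΛ : Measurable fun z : ℝ × ((Fin M → ℂ) × (Fin M → ℂ)) => c.Λ k lam z.1 :=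
      (c.measurable_Λ k lam).comp measurable_fst
    exact Measurable.ite (measurableSet_le (hΛ.max measurable_const) hD) measurable_const
      (Measurable.ite (measurableSet_lt (hD.max hΛ) measurable_const) measurable_const
        measurable_const)
  have hr : Measurable fun z : ℝ × ((Fin M → ℂ) × (Fin M → ℂ)) =>
      c.rateR z.1 (Params.cascade z.2) :=
    c.measurable_rateR.comp
      (measurable_fst.prodMk (Params.measurable_cascade.comp measurable_snd))
  exact MeasurableSet.union (hf (MeasurableSpace.measurableSet_top (s := {Action.halt})))
    (MeasurableSet.inter (hf (MeasurableSpace.measurableSet_top (s := {Action.assist})))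
      (measurableSet_le measurable_const hr))

/-- The probability that the rule stops at a given contention. -/
def stopProb (c : Params K M) (lam : ℝ) : ℝ :=
  ∑ k, c.winProb k * ((c.lawAbsH k).prod (c.lawFG k)).real (stopRegion c lam k)

end Rule

variable {K M : ℕ} {c : Params K M} {Ω : Type*} [mΩ : MeasurableSpace Ω] {P : Measure Ω}
  [NeZero K] {N : Network c P} {S : Strategy Ω}

attribute [local irreducible] Params.rateD Params.rateR

/-! ### The decision rule is observable -/

open Classical in
/-- The rule with price `lam`. -/
def rule (N : Network c P) (lam : ℝ) : Strategy Ω where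
  first n ω := ruleFirst c lam (N.w n ω) ‖N.hw n ω‖
  -- The coefficients are masked exactly as in `seen`, which keeps this decision observable even
  -- where the RIS is not probed.
  second n ω := decide (lam ≤ c.rateR ‖N.hw n ω‖
    (if ruleFirst c lam (N.w n ω) ‖N.hw n ω‖ = Action.assist then N.qw n ω else 0))

theorem followsRule_rule (lam : ℝ) : N.FollowsRule lam (N.rule lam) := by
  intro n ω
  refine ⟨fun h => ?_, fun h => ?_, fun h1 h2 => ?_⟩
  · simp only [rule, ruleFirst, if_pos h]
  · have hn : ¬ max (c.Λ (N.w n ω) lam ‖N.hw n ω‖) 0 ≤ c.direct lam ‖N.hw n ω‖ := fun h' => by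
      have := (le_max_right _ _).trans h'
      have := (le_max_left _ _).trans_lt h
      linarith
    simp only [rule, ruleFirst, if_neg hn, if_pos h]
  · have hf : ruleFirst c lam (N.w n ω) ‖N.hw n ω‖ = Action.assist := by
      rw [ruleFirst, if_neg h1, if_neg h2]
    exact ⟨hf, by simp only [rule, hf, if_true, decide_eq_true_eq]⟩

theorem admissible_rule (lam : ℝ) : N.Admissible (N.rule lam) := by
  intro n
  have hobs : Measurable[N.info₁ (N.rule lam) n] (N.obs n) :=
    (comap_measurable _).mono (le_sup_of_le_left (le_iSup₂_of_le n le_rfl le_rfl)) le_rfl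
  have hfirst := (measurable_ruleFirst (c := c) lam).comp hobs
  simp only [Function.comp_def, obs] at hfirst
  refine ⟨hfirst, ?_⟩
  have hobs₂ : Measurable[N.info₂ (N.rule lam) n] (N.obs n) := hobs.mono le_sup_left le_rfl
  have hx : Measurable[N.info₂ (N.rule lam) n] (fun ω => ‖N.hw n ω‖) :=
    measurable_norm.comp (measurable_snd.comp (measurable_snd.comp hobs₂))
  have hseen : Measurable[N.info₂ (N.rule lam) n] (N.seen (N.rule lam) n) :=
    (comap_measurable _).mono le_sup_right le_rfl
  have hrate : Measurable[N.info₂ (N.rule lam) n]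
      (fun ω => c.rateR ‖N.hw n ω‖ (N.seen (N.rule lam) n ω)) :=
    c.measurable_rateR.comp (hx.prodMk hseen)
  refine @measurable_to_bool _ (N.info₂ (N.rule lam) n) _ ?_
  have heq : (N.rule lam).second n ⁻¹' {true} =
      (fun ω => c.rateR ‖N.hw n ω‖ (N.seen (N.rule lam) n ω)) ⁻¹' Set.Ici lam := by
    ext ω
    simp only [rule, seen, Set.mem_preimage, Set.mem_singleton_iff, decide_eq_true_eq, Set.mem_Ici]
    congr!
  rw [heq]
  exact hrate measurableSet_Ici

/-! ### The decision rule is optimal -/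

theorem first_eq_ruleFirst {lam : ℝ} (hR : N.FollowsRule lam S) (n : ℕ) (ω : Ω) :
    S.first n ω = ruleFirst c lam (N.w n ω) ‖N.hw n ω‖ := by
  obtain ⟨h1, h2, h3⟩ := hR n ω
  unfold ruleFirst
  split_ifs with ha hb
  exacts [h1 ha, h2 hb, (h3 ha hb).1]

theorem second_iff {lam : ℝ} (hR : N.FollowsRule lam S) {n : ℕ} {ω : Ω}
    (h : S.first n ω = Action.assist) :
    S.second n ω = true ↔ lam ≤ c.rateR ‖N.hw n ω‖ (N.qw n ω) := by
  obtain ⟨h1, h2, h3⟩ := hR n ω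
  by_cases ha : max (c.Λ (N.w n ω) lam ‖N.hw n ω‖) 0 ≤ c.direct lam ‖N.hw n ω‖
  · have := h1 ha
    rw [this] at h
    cases h
  by_cases hb : max (c.direct lam ‖N.hw n ω‖) (c.Λ (N.w n ω) lam ‖N.hw n ω‖) < 0
  · have := h2 hb
    rw [this] at h
    cases h
  exact (h3 ha hb).2

theorem beforeSecond_eq_gain {lam : ℝ} (hR : N.FollowsRule lam S) (n : ℕ) (ω : Ω) :
    N.beforeSecond S lam n ω = c.gain (N.w n ω) lam ‖N.hw n ω‖ := by
  have hf := first_eq_ruleFirst hR n ω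
  unfold ruleFirst at hf
  unfold beforeSecond Params.gain
  split_ifs at hf with ha hb
  · rw [if_pos hf, max_eq_left ((le_max_left _ _).trans ha),
      max_eq_left ((le_max_right _ _).trans ha)]
  · rw [if_neg (by simp [hf]), Set.indicator_of_notMem (by simp [hf]), max_eq_right hb.le]
  · rw [if_neg (by simp [hf]), Set.indicator_of_mem (by simp [hf])]
    -- Failure of both tests forces `Λ` to be the largest term: a negative direct reward leaves `Λ ≥
    -- 0`, a nonnegative one leaves `Λ` above it.
    rw [max_le_iff, not_and_or, not_le, not_le] at ha
    rw [max_lt_iff, not_and_or, not_lt, not_lt] at hb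
    rcases lt_or_ge (c.direct lam ‖N.hw n ω‖) 0 with h0 | h0
    · have hΛ := hb.resolve_left (not_le.2 h0)
      rw [max_eq_right (h0.le.trans hΛ), max_eq_left hΛ]
    · have hΛ := ha.resolve_right (not_lt.2 h0)
      rw [max_eq_right hΛ.le, max_eq_left (h0.trans hΛ.le)]

/-- After probing, stopping beats continuing by `(τd - τM2) * (R - lam)`, so the sign of `R - lam`
selects the maximum; if `τd = τM2` both branches agree. -/
theorem step_eq_afterFirst {lam : ℝ} (hR : N.FollowsRule lam S) (n : ℕ) (ω : Ω) :
    N.stepY S n ω - lam * stepCost (c := c) S n ω = N.afterFirst S lam n ω := by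
  have h2 := c.τM2_eq
  have h3 := sub_nonneg.2 c.τM2_le_τd
  have h4 : lam * c.τM2 = lam * (c.τM1 + (c.τp + c.τC)) := by rw [h2]
  have hsec := second_iff hR (n := n) (ω := ω)
  unfold stepY stepCost afterFirst Params.direct Params.probed
  rcases hf : S.first n ω with _ | _ | _
  · simp only [Strategy.StopsAt, hf, true_or, if_true]
    ring
  · simp [Strategy.StopsAt, hf]
  · have hsec := hsec hf
    by_cases hs : S.second n ω = true
    · have hle := mul_nonneg h3 (sub_nonneg.2 (hsec.1 hs))
      simp only [Strategy.StopsAt, hf, hs, and_self, or_true, reduceCtorEq, if_false, if_true,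
        Set.indicator_of_mem (show ω ∈ {ω | S.first n ω = Action.assist} from hf)]
      rw [max_eq_left (by linarith)]
    · have hle := mul_nonneg h3 (sub_nonneg.2 (not_le.1 (mt hsec.2 hs)).le)
      simp only [Strategy.StopsAt, hf, hs, reduceCtorEq, and_false, or_self, if_false, if_true,
        Set.indicator_of_mem (show ω ∈ {ω | S.first n ω = Action.assist} from hf)]
      rw [max_eq_right (by linarith)]
      ring

theorem stopsAt_iff_mem_stopRegion {lam : ℝ} (hR : N.FollowsRule lam S) (n : ℕ) (ω : Ω) :
    S.StopsAt n ω ↔ (‖N.hw n ω‖, N.fg n (N.w n ω) ω) ∈ stopRegion c lam (N.w n ω) := by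
  unfold Strategy.StopsAt stopRegion
  rw [Set.mem_ofPred_eq, ← first_eq_ruleFirst hR n ω]
  refine or_congr_right (and_congr_right fun h => ?_)
  exact second_iff hR h

variable [IsProbabilityMeasure P]

/-- Stopping under the rule means that the channels of the current winner fall in a fixed region, so
`setIntegral_contention` applies to its indicator. -/
theorem real_inter_stopsAt {lam : ℝ} (hS : N.Admissible S) (hR : N.FollowsRule lam S) (n : ℕ)
    {A : Set Ω} (hA : MeasurableSet[N.block (Idx.past n)] A) :
    P.real (A ∩ {ω | S.StopsAt n ω}) = P.real A * stopProb c lam := by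
  have hm := fun k => measurableSet_stopRegion (c := c) lam k
  have h := (N.setIntegral_contention n hA
    (φ := fun k => (stopRegion c lam k).indicator fun _ => (1 : ℝ))
    (fun k => measurable_const.indicator (hm k))
    fun k => (integrable_const (1 : ℝ)).indicator (hm k)).2
  have hends : MeasurableSet {ω | S.StopsAt n ω} :=
    N.block_le _ _ (measurableSet_stopsAt hS n)
  have heq : ∀ ω, (stopRegion c lam (N.w n ω)).indicator (fun _ => (1 : ℝ))
      (‖N.hw n ω‖, N.fg n (N.w n ω) ω) = {ω | S.StopsAt n ω}.indicator (fun _ => 1) ω := by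
    intro ω
    classical
    simp only [Set.indicator_apply, ← stopsAt_iff_mem_stopRegion hR n ω, Set.mem_ofPred_eq]
  have hone : ∀ k, ∫ z, (stopRegion c lam k).indicator (fun _ => (1 : ℝ)) z
      ∂((c.lawAbsH k).prod (c.lawFG k)) =
      ((c.lawAbsH k).prod (c.lawFG k)).real (stopRegion c lam k) := fun k => by
    rw [integral_indicator_const _ (hm k), smul_eq_mul, mul_one]
  calc P.real (A ∩ {ω | S.StopsAt n ω})
      = ∫ ω in A, {ω | S.StopsAt n ω}.indicator (fun _ => (1 : ℝ)) ω ∂P := by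
        rw [setIntegral_indicator hends, setIntegral_const, smul_eq_mul, mul_one]
    _ = _ := integral_congr_ae (Filter.Eventually.of_forall fun ω => (heq ω).symm)
    _ = _ := h
    _ = P.real A * stopProb c lam :=
        congrArg _ (Finset.sum_congr rfl fun k _ => congrArg _ (hone k))

/-- If the rule never stopped at contention 0, it would earn nothing there. The equality case of
`setIntegral_step_le` would then make `lam` times a positive mean time vanish. -/
theorem stopProb_pos {lam : ℝ} (h0 : 0 < lam) (hlam : c.meanGain lam = lam * c.τo)
    (hS : N.Admissible S) (hR : N.FollowsRule lam S) : 0 < stopProb c lam := by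
  have hp := real_inter_stopsAt hS hR 0 (@MeasurableSet.univ _ (N.block _))
  rw [Set.univ_inter, probReal_univ, one_mul] at hp
  rw [← hp]
  refine lt_of_le_of_ne measureReal_nonneg fun hzero => ?_
  have heq := (setIntegral_step_le hS hlam 0 (@MeasurableSet.univ _ (N.block _))).2
    (step_eq_afterFirst hR 0) (beforeSecond_eq_gain hR 0)
  rw [setIntegral_univ, setIntegral_univ] at heq
  have hY : ∫ ω, N.stepY S 0 ω ∂P = 0 := by
    refine integral_eq_zero_of_ae ?_
    have : ∀ᵐ ω ∂P, ¬ S.StopsAt 0 ω := by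
      rw [ae_iff]
      simpa using (measureReal_eq_zero_iff).1 hzero.symm
    filter_upwards [this] with ω hω
    rw [stepY, if_neg hω]
    rfl
  have hT := integral_mono (integrable_const c.τM1) (integrable_stepT hS 0) fun ω =>
    (N.τM1_le_t 0 ω).trans (le_add_of_nonneg_right (stepCost_nonneg S 0 ω))
  simp only [integral_const, probReal_univ, one_smul] at hT
  have := c.τM1_pos
  rw [hY] at heq
  have := mul_pos h0 (c.τM1_pos.trans_le hT)
  linarith

theorem real_running {lam : ℝ} (hS : N.Admissible S) (hR : N.FollowsRule lam S) (n : ℕ) :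
    P.real {ω | S.Running n ω} = (1 - stopProb c lam) ^ n := by
  induction n with
  | zero => simp [Strategy.Running]
  | succ n ih =>
    have hset : {ω | S.Running (n + 1) ω} =
        {ω | S.Running n ω} \ ({ω | S.Running n ω} ∩ {ω | S.StopsAt n ω}) := by
      ext ω
      simp only [Strategy.running_succ_iff, Set.mem_ofPred_eq, Set.mem_sdiff, Set.mem_inter_iff]
      tauto
    rw [hset, measureReal_sdiff Set.inter_subset_left
      ((N.block_le _ _ (measurableSet_running hS n)).inter
        (N.block_le _ _ (measurableSet_stopsAt hS n))),
      real_inter_stopsAt hS hR n (measurableSet_running hS n), ih]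
    ring

theorem feasible_of_followsRule {lam : ℝ} (h0 : 0 < lam) (hlam : c.meanGain lam = lam * c.τo)
    (hS : N.Admissible S) (hR : N.FollowsRule lam S) : N.Feasible S := by
  have hq := stopProb_pos h0 hlam hS hR
  have hr0 : 0 ≤ 1 - stopProb c lam := by
    have := real_running hS hR 1
    rw [pow_one] at this
    rw [← this]
    exact measureReal_nonneg
  have hr1 : 1 - stopProb c lam < 1 := by linarith
  have hends : ∀ᵐ ω ∂P, ∃ n, S.StopsAt n ω := by
    rw [ae_iff, ← measureReal_eq_zero_iff]
    refine le_antisymm (ge_of_tendsto' (tendsto_pow_atTop_nhds_zero_of_lt_one hr0 hr1) fun n => ?_)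
      measureReal_nonneg
    rw [← real_running hS hR n]
    exact measureReal_mono fun ω hω l _ hl => hω ⟨l, hl⟩
  refine ⟨hS, hends, ?_⟩
  have hT0 : ∀ ω, 0 ≤ N.T S ω := fun ω => c.τM1_pos.le.trans (τM1_le_T ω)
  refine (lintegral_ofReal_ne_top_iff_integrable (measurable_T hS).aestronglyMeasurable
    (Filter.Eventually.of_forall hT0)).1 ?_
  rw [lintegral_T hS hends]
  -- The mean time per contention is bounded and the survival probabilities are geometric, so E[T]
  -- is dominated by a geometric series.
  have hstep : ∀ n, ∫ ω in {ω | S.Running n ω}, N.stepT S n ω ∂P ≤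
      (1 - stopProb c lam) ^ n * (c.τo + (c.τd - c.τM1)) := by
    intro n
    have ht := (N.integrable_t_and_integral_t n).1
    have hle := setIntegral_mono (s := {ω | S.Running n ω}) (integrable_stepT hS n).integrableOn
      (ht.add (integrable_const (c.τd - c.τM1))).integrableOn
      fun ω => add_le_add_right (stepCost_le (c := c) S n ω) (N.t n ω)
    refine hle.trans (le_of_eq ?_)
    rw [integral_add' ht.restrict (integrable_const _),
      N.setIntegral_t n (measurableSet_running hS n),
      setIntegral_const, real_running hS hR, smul_eq_mul]
    ring
  have hC : 0 ≤ c.τo + (c.τd - c.τM1) :=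
    add_nonneg N.τo_pos.le (sub_nonneg.2 c.τM1_lt_τd.le)
  refine ne_top_of_le_ne_top ?_ (ENNReal.tsum_le_tsum fun n => ENNReal.ofReal_le_ofReal (hstep n))
  rw [← ENNReal.ofReal_tsum_of_nonneg (fun n => mul_nonneg (pow_nonneg hr0 n) hC)
    ((summable_geometric_of_lt_one hr0 hr1).mul_right _)]
  exact ENNReal.ofReal_ne_top

theorem throughput_of_followsRule {lam : ℝ} (h0 : 0 < lam) (hlam : c.meanGain lam = lam * c.τo)
    (hS : N.Admissible S) (hR : N.FollowsRule lam S) : N.throughput S = lam := by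
  have hF := feasible_of_followsRule h0 hlam hS hR
  have hT0 : ∀ ω, 0 ≤ N.T S ω := fun ω => c.τM1_pos.le.trans (τM1_le_T ω)
  have hY := (integrable_Y_and_throughput_le h0.le hlam hF).1
  -- The termwise comparison of the upper bound, now with equality in every term.
  have heq : ∫⁻ ω, ENNReal.ofReal (N.Y S ω) ∂P =
      ENNReal.ofReal lam * ∫⁻ ω, ENNReal.ofReal (N.T S ω) ∂P := by
    rw [lintegral_Y hS hF.2.1, lintegral_T hS hF.2.1, ← ENNReal.tsum_mul_left]
    refine tsum_congr fun n => ?_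
    rw [← ENNReal.ofReal_mul h0.le, (setIntegral_step_le hS hlam n (measurableSet_running hS n)).2
      (step_eq_afterFirst hR n) (beforeSecond_eq_gain hR n)]
  rw [← ofReal_integral_eq_lintegral_ofReal hY (Filter.Eventually.of_forall Y_nonneg),
    ← ofReal_integral_eq_lintegral_ofReal hF.2.2 (Filter.Eventually.of_forall hT0),
    ← ENNReal.ofReal_mul h0.le, ENNReal.ofReal_eq_ofReal_iff (integral_nonneg Y_nonneg)
      (mul_nonneg h0.le (integral_nonneg hT0))] at heq
  rw [throughput, heq, mul_div_cancel_right₀ _ (integral_T_pos hF.2.2).ne']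

end Network

end RISCSMA

end

theorem theorem1 {K M : ℕ} [NeZero K] (c : RISCSMA.Params K M) {Ω : Type*} [MeasurableSpace Ω]
    (P : Measure Ω) [IsProbabilityMeasure P] (N : RISCSMA.Network c P) :
    -- the mean duration and the winner's law of a successful contention
    (∀ n, Integrable (N.t n) P ∧ ∫ ω, N.t n ω ∂P = c.τo) ∧
    (∀ n k, P.real {ω | N.w n ω = k} = c.winProb k) ∧
    -- the amplitude of the direct link is Rayleigh distributed
    (∀ k x, 0 ≤ x → (c.lawAbsH k).real (Set.Iic x) =
      1 - Real.exp (-(x ^ 2 / c.d k ^ (-c.α₁)))) ∧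
    -- the phases used after probing the RIS attain the rate of the RIS-assisted link
    (∀ (h : ℂ) (f g : Fin M → ℂ),
      c.ratePhase (RISCSMA.optPhase h f g) h f g = c.rateR ‖h‖ (fun m => f m * g m) ∧
      ∀ φ : Fin M → ℝ, c.ratePhase φ h f g ≤ c.rateR ‖h‖ (fun m => f m * g m)) ∧
    -- the expectations in the fixed-point equation exist
    (∀ k lam x, 0 ≤ x →
      Integrable (fun y => c.probed lam x (fun m => y.1 m * y.2 m)) (c.lawFG k)) ∧
    (∀ k lam, IntegrableOn (c.gain k lam) (Set.Ici 0) (c.lawAbsH k)) ∧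
    ∃ lamStar : ℝ, 0 < lamStar ∧
      -- the optimal throughput is the unique root of the fixed-point equation
      (∀ lam : ℝ, ∑ k, c.winProb k * (∫ x in Set.Ici 0, c.gain k lam x ∂(c.lawAbsH k)) =
        lam * c.τo ↔ lam = lamStar) ∧
      -- for equal contention probabilities all pairs have weight `1 / K`
      ((∀ i j, c.p i = c.p j) →
        ∀ lam : ℝ, (1 / (K : ℝ)) * (∑ k, ∫ x in Set.Ici 0, c.gain k lam x ∂(c.lawAbsH k)) =
          lam * c.τo ↔ lam = lamStar) ∧
      -- no feasible strategy has a larger throughput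
      (∀ S, N.Feasible S → Integrable (N.Y S) P ∧ N.throughput S ≤ lamStar) ∧
      -- the rule defines an observable strategy, which is feasible and attains the optimum
      (∃ S, N.Admissible S ∧ N.FollowsRule lamStar S) ∧
      ∀ S, N.Admissible S → N.FollowsRule lamStar S →
        N.Feasible S ∧ N.throughput S = lamStar := by
  obtain ⟨lamStar, hpos, hroot⟩ := c.exists_meanGain_eq N.τo_pos
  have hlam : c.meanGain lamStar = lamStar * c.τo := (hroot lamStar).2 rfl
  refine ⟨fun n => N.integrable_t_and_integral_t n, fun n k => N.real_w n k,
    fun k x hx => c.lawAbsH_real_Iic k hx,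
    fun h f g => ⟨c.ratePhase_optPhase h f g, fun φ => c.ratePhase_le φ h f g⟩,
    fun k lam x _ => c.integrable_probed k lam x,
    fun k lam => (c.integrable_gain k lam).integrableOn,
    lamStar, hpos, fun lam => ?_, fun hp lam => ?_,
    fun S hS => RISCSMA.Network.integrable_Y_and_throughput_le hpos.le hlam hS,
    ⟨N.rule lamStar, RISCSMA.Network.admissible_rule lamStar,
      RISCSMA.Network.followsRule_rule lamStar⟩,
    fun S hS hR => ⟨RISCSMA.Network.feasible_of_followsRule hpos hlam hS hR,
      RISCSMA.Network.throughput_of_followsRule hpos hlam hS hR⟩⟩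
  · rw [c.sum_winProb_setIntegral]
    exact hroot lam
  · rw [← hroot lam, ← c.sum_winProb_setIntegral, Finset.mul_sum]
    simp only [c.winProb_eq_of_forall_p_eq hp]
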